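/- Let $3<p<5$ and $s_p=\frac32-\frac2{p-1}$. Let $R_W\ge 0$ and let $W\in C^2(\{x\in\mathbb R^3:|x|>R_W\})$ be a real-valued radial function with $|W(x)|\lesssim |x|^{-1}$ and $|\nabla W(x)|\lesssim|x|^{-2}$ for large $|x|$. Let $C_4,C_5$ be constants. Then there is a constant $R_0>R_W$, depending only on $p$, $C_4$, $C_5$ and $W$ (with its domain $|x|>R_W$), such that the following holds. Let $F:[0,\infty)\times\mathbb R\to\mathbb R$ be any continuous function with $$|F(r,a)|\le |a|^p,\qquad |F(r,a)-F(r,b)|\le C_5|a-b|\left(|a|^{p-1}+|b|^{p-1}\right)\qquad(r\ge0,\ a,b\in\mathbb R),$$ and such that $-\Delta W=F(|x|,W)$ for $|x|>R_W$. Let $u$ be a real-valued radial solution of $\partial_t^2u-\Delta u=F(|x|,u)$ defined for all $t\in\mathbb R$; that is, $(u,\partial_tu)\in C(\mathbb R;\dot H^{s_p}\times\dot H^{s_p-1}(\mathbb R^3))$, the norm of $u$ in $L^{\frac{2p}{1+s_p}}_tL^{\frac{2p}{2-s_p}}_x(J\times\mathbb R^3)$ is finite for every bounded closed interval $J$, and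 for all $t,t_0\in\mathbb R$ $$u(t)=\cos\big((t-t_0)\sqrt{-\Delta}\big)u(t_0)+\frac{\sin\big((t-t_0)\sqrt{-\Delta}\big)}{\sqrt{-\Delta}}\partial_tu(t_0)+\int_{t_0}^t\frac{\sin\big((t-\tau)\sqrt{-\Delta}\big)}{\sqrt{-\Delta}}F(|\cdot|,u(\tau))\,d\tau$$ in the sense of tempered distributions. Suppose that (I) for each $t\in\mathbb R$, $\nabla u(\cdot,t)$ and $\partial_tu(\cdot,t)$ are functions on $\mathbb R^3\setminus\{0\}$ and, for every $r>0$, $$\int_{r<|x|<4r}\left(|\nabla u(x,t)|^2+|\partial_tu(x,t)|^2\right)dx\le C_4r^{-1};$$ (II) there are constants $C,\rho$ such that $|u(x,t)-W(x)|\le C|x|^{2-p}$ for all $t\in\mathbb R$ and (almost) all $|x|>\rho$. Then for every $t\in\mathbb R$ we have $u(x,t)-W(x)=0$ for (almost) every $x$ with $|x|>R_0$, and $\partial_tu(\cdot,t)=0$ on $\{|x|>R_0\}$. -/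

import Mathlib

open MeasureTheory Filter Topology
open scoped SchwartzMap FourierTransform ENNReal Laplacian

noncomputable section

namespace RadialWave

/-- Three-dimensional Euclidean space. -/
abbrev E3 : Type := EuclideanSpace ℝ (Fin 3)

/-- The critical Sobolev exponent `s_p = 3/2 - 2/(p-1)`. -/
def sp (p : ℝ) : ℝ := 3 / 2 - 2 / (p - 1)

/-- `f` is radial on `Ω`: its value depends only on `|x|`. -/
def IsRadialOn (f : E3 → ℝ) (Ω : Set E3) : Prop :=
  ∀ x ∈ Ω, ∀ y ∈ Ω, ‖x‖ = ‖y‖ → f x = f y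

/-- The tempered distribution `T` is the function `f`: every Schwartz function `φ` is integrable
against `f`, and `T φ = ∫ φ f`. -/
def IsRepresentedBy (T : 𝓢'(E3, ℂ)) (f : E3 → ℂ) : Prop :=
  ∀ φ : 𝓢(E3, ℂ), Integrable (fun x => φ x * f x) ∧ T φ = ∫ x, φ x * f x

/-- The restriction of the distribution `T` to the open set `Ω` is the locally integrable real
function `f`. -/
def IsRepresentedOn (T : 𝓢'(E3, ℂ)) (f : E3 → ℝ) (Ω : Set E3) : Prop :=
  LocallyIntegrableOn f Ω ∧
    ∀ φ : 𝓢(E3, ℂ), HasCompactSupport (φ : E3 → ℂ) → tsupport (φ : E3 → ℂ) ⊆ Ω →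
      T φ = ∫ x, φ x * (f x : ℂ)

/-- `g` is the weak gradient of `f` on the open set `Ω`. -/
def IsWeakGradientOn (f : E3 → ℝ) (g : E3 → E3) (Ω : Set E3) : Prop :=
  LocallyIntegrableOn f Ω ∧ LocallyIntegrableOn g Ω ∧
    ∀ φ : E3 → ℝ, ContDiff ℝ (⊤ : ℕ∞) φ → HasCompactSupport φ → tsupport φ ⊆ Ω →
      ∀ e : E3, ∫ x, f x * fderiv ℝ φ x e = - ∫ x, inner ℝ (g x) e * φ x

/-- The homogeneous Sobolev norm `‖T‖_{Ḣ^s} = ‖ |2πξ|^s 𝓕T ‖_{L²}`; it is `∞` unless `𝓕T` is a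
function `g` (which is then unique up to null sets) with `|2πξ|^s g ∈ L²`. -/
def homSobolevENorm (s : ℝ) (T : 𝓢'(E3, ℂ)) : ℝ≥0∞ :=
  ⨅ (g : E3 → ℂ) (_ : IsRepresentedBy (𝓕 T) g),
    (∫⁻ ξ, ENNReal.ofReal ((2 * Real.pi * ‖ξ‖) ^ (2 * s)) * ‖g ξ‖ₑ ^ 2) ^ (1 / 2 : ℝ)

/-- A curve of distributions lies in `C(ℝ; Ḣ^s)`. -/
def ContinuousInHomSobolev (s : ℝ) (T : ℝ → 𝓢'(E3, ℂ)) : Prop :=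
  (∀ t, homSobolevENorm s (T t) < ⊤) ∧
    ∀ t₀, Tendsto (fun t => homSobolevENorm s (T t - T t₀)) (𝓝 t₀) (𝓝 0)

/-- The mixed norm `‖u‖_{L^q_t L^r_x(J × ℝ³)}`, for finite positive exponents. -/
def mixedENorm (q r : ℝ) (J : Set ℝ) (u : ℝ → E3 → ℝ) : ℝ≥0∞ :=
  (∫⁻ t in J, (∫⁻ x, ‖u t x‖ₑ ^ r) ^ (q / r)) ^ (1 / q)

/-- The norm `‖u‖_{Y(J)}`, `Y(J) = L^{2p/(1+s_p)} L^{2p/(2-s_p)}(J × ℝ³)`. -/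
def yENorm (p : ℝ) (J : Set ℝ) (u : ℝ → E3 → ℝ) : ℝ≥0∞ :=
  mixedENorm (2 * p / (1 + sp p)) (2 * p / (2 - sp p)) J u

/-- The symbol `cos(t|2πξ|)` of `cos(t√-Δ)`. -/
def cosSymbol (t : ℝ) (ξ : E3) : ℂ := (Real.cos (t * (2 * Real.pi * ‖ξ‖)) : ℂ)

/-- The symbol `sin(t|2πξ|)/|2πξ|` of `sin(t√-Δ)/√-Δ`, with its limit `t` at `ξ = 0`. -/
def sinSymbol (t : ℝ) (ξ : E3) : ℂ := (t * Real.sinc (t * (2 * Real.pi * ‖ξ‖)) : ℝ)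

/-- The first component of the free wave propagator,
`S_{L,0}(t)(f₀, f₁) = cos(t√-Δ) f₀ + (sin(t√-Δ)/√-Δ) f₁`. -/
def freeWave (t : ℝ) (f₀ f₁ : 𝓢'(E3, ℂ)) : 𝓢'(E3, ℂ) :=
  TemperedDistribution.fourierMultiplierCLM ℂ (cosSymbol t) f₀ +
    TemperedDistribution.fourierMultiplierCLM ℂ (sinSymbol t) f₁

/-- `(u, ∂ₜu)` is a solution, on the whole time axis, of `∂ₜ²u - Δu = F(|x|,u)`. Here `u t` is the
function `u(·,t)`, `U t` is `u(·,t)` as a tempered distribution, and `ut t` is the tempered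
distribution `∂ₜu(·,t)`. -/
structure IsGlobalSolution (p : ℝ) (F : ℝ → ℝ → ℝ) (u : ℝ → E3 → ℝ)
    (U ut : ℝ → 𝓢'(E3, ℂ)) : Prop where
  measurable : AEStronglyMeasurable (fun z : ℝ × E3 => u z.1 z.2)
  represents : ∀ t, IsRepresentedBy (U t) (fun x => (u t x : ℂ))
  /-- `ut` is the time derivative of `u`, in the sense of distributions in `x`. -/
  time_deriv : ∀ t (φ : 𝓢(E3, ℂ)), HasDerivAt (fun τ => U τ φ) (ut t φ) t
  continuous_u : ContinuousInHomSobolev (sp p) U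
  continuous_ut : ContinuousInHomSobolev (sp p - 1) ut
  finite_y : ∀ a b : ℝ, yENorm p (Set.Icc a b) u < ⊤
  /-- The integral equation, as an identity of tempered distributions: the Duhamel term is tested
  against `φ` through the self-adjointness of `sin((t-τ)√-Δ)/√-Δ`. -/
  duhamel : ∀ (t t₀ : ℝ) (φ : 𝓢(E3, ℂ)),
    U t φ = freeWave (t - t₀) (U t₀) (ut t₀) φ +
      ∫ τ in t₀..t, ∫ x, (F ‖x‖ (u τ x) : ℂ) *
        SchwartzMap.fourierMultiplierCLM ℂ (sinSymbol (t - τ)) φ x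

/-- Away from the origin `f` has a weak gradient `∇f`, `f₁` is a function, and
`∫_{r<|x|<4r} (|∇f|² + |f₁|²) dx ≤ C r⁻¹` for every `r > 0`. -/
def HasLocalEnergyBound (C : ℝ) (f : E3 → ℝ) (f₁ : 𝓢'(E3, ℂ)) : Prop :=
  ∃ (g : E3 → E3) (v : E3 → ℝ),
    IsWeakGradientOn f g {0}ᶜ ∧ IsRepresentedOn f₁ v {0}ᶜ ∧
    ∀ r : ℝ, 0 < r →
      ∫⁻ x in {x : E3 | r < ‖x‖ ∧ ‖x‖ < 4 * r}, (‖g x‖ₑ ^ 2 + ‖v x‖ₑ ^ 2)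
        ≤ ENNReal.ofReal (C * r⁻¹)

end RadialWave

end

/-! In three dimensions `r u` solves a one-dimensional wave equation, so `u - W` can be solved for
inwards from spatial infinity. Put `h = u - W` and `q = 3 - p < 0`. Hypothesis (II) says `|h| ≤ A
|x|^(q-1)` far out, uniformly in time; since `q < 0`, `r h` tends to zero at infinity. For a bump
`ϕ`, apply d'Alembert's formula centred at time `t` to the translate `ϕ(r - a)`, forward and
backward by `a`, and add. The velocity terms cancel, and at time `t` there remain `h` against `ϕ`,
which is wanted, and `h` against `ϕ(r - 2a)`. The latter and the terms at times `t ± a` vanish as `a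
→ ∞`. Hence `h(t)` is determined by the forcing `F(|x|,u) - F(|x|,W)` alone
(`IsGlobalSolution.radial_duhamel_add`, `ae_abs_sub_le_barrier`).

The forcing is estimated with a barrier. If `|u|` and `|W|` are `O(1/|x|)`, the Lipschitz bound
gives `|F(|x|,u) - F(|x|,W)| ≤ K₂ A |x|^(2q-3)`. This is a multiple of the Laplacian of
`|x|^(2q-1)`, a time-independent function whose own d'Alembert identity evaluates the resulting
Duhamel integrals exactly (`IsStationary.dalembert`, `abs_forcing_difference_le`). So `|h| ≤ (K₂ A /
κ) |x|^(2q-1)` with `κ = 2q(2q-1)`, a gain of `|x|^q` over the initial bound. Beyond an `R₀` with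
`(K₂ / κ) R₀^q ≤ 1/2` the constant `A` halves at every pass, so `h = 0` there. The starting `A`
depends on the solution, but `R₀` does not see it.

For this `K₂` must not depend on the solution either. The bound `|u| ≤ K₁/|x|` therefore comes from
(I): the radial derivative is integrated inwards from infinity, and (II) only says that nothing is
left at infinity (`ae_abs_le_of_energy`).

Everything is done weakly, against the test functions `ϕ(|x|)/|x|` with `ϕ` supported away from the
origin. The Fourier multipliers act on them by d'Alembert's formula as long as the translates do not
reach the origin (`freeWave_radialTest`); pairings are turned back into pointwise bounds by Lebesgue
differentiation (`ae_abs_le_of_abs_radialPair_le`). -/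

noncomputable section

namespace RadialWave

/-! ### Temperate growth of the wave symbols -/

/-- The kernels `∫₀¹ (1 - z²)ᵏ cos (zρ) dz`, which are even entire functions of `ρ`. -/
def besselKernel (k : ℕ) (ρ : ℝ) : ℝ := ∫ z in (0 : ℝ)..1, (1 - z ^ 2) ^ k * Real.cos (z * ρ)

lemma abs_one_sub_sq_pow_le {z : ℝ} (hz : z ∈ Set.uIoc (0 : ℝ) 1) (k : ℕ) :
    |(1 - z ^ 2) ^ k| ≤ 1 := by
  rw [Set.uIoc_of_le zero_le_one] at hz
  rw [abs_pow]
  refine pow_le_one₀ (abs_nonneg _) ?_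
  rw [abs_le]
  constructor <;> nlinarith [hz.1, hz.2]

lemma abs_besselKernel_le (k : ℕ) (ρ : ℝ) : |besselKernel k ρ| ≤ 1 := by
  have := intervalIntegral.norm_integral_le_of_norm_le_const (a := 0) (b := 1) (C := 1)
    (f := fun z : ℝ => (1 - z ^ 2) ^ k * Real.cos (z * ρ)) (fun z hz => by
      rw [norm_mul]
      exact mul_le_one₀ (abs_one_sub_sq_pow_le hz k) (norm_nonneg _) (Real.abs_cos_le_one _))
  simpa [besselKernel] using this

/-- Differentiate under the integral, then integrate by parts in `z`. The explicit factor `ρ` in the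
derivative is what makes the radial function smooth at the origin. -/
lemma hasDerivAt_besselKernel (k : ℕ) (ρ : ℝ) :
    HasDerivAt (besselKernel k) (-(ρ / (2 * (k + 1))) * besselKernel (k + 1) ρ) ρ := by
  have h1 : HasDerivAt (besselKernel k)
      (∫ z in (0 : ℝ)..1, (1 - z ^ 2) ^ k * (-Real.sin (z * ρ) * z)) ρ := by
    refine (intervalIntegral.hasDerivAt_integral_of_dominated_loc_of_deriv_le
      (F := fun ρ z => (1 - z ^ 2) ^ k * Real.cos (z * ρ))
      (F' := fun ρ z => (1 - z ^ 2) ^ k * (-Real.sin (z * ρ) * z)) (bound := fun _ => 1)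
      Filter.univ_mem ?_ ?_ ?_ ?_ ?_ ?_).2
    · exact Eventually.of_forall fun x => Continuous.aestronglyMeasurable (by fun_prop)
    · exact Continuous.intervalIntegrable (by fun_prop) _ _
    · exact Continuous.aestronglyMeasurable (by fun_prop)
    · refine Eventually.of_forall fun z hz x _ => ?_
      have h1 := abs_one_sub_sq_pow_le hz k
      rw [Set.uIoc_of_le zero_le_one] at hz
      rw [norm_mul, norm_mul, norm_neg]
      refine mul_le_one₀ h1 (by positivity) (mul_le_one₀ (Real.abs_sin_le_one _) (norm_nonneg _) ?_)
      rw [Real.norm_eq_abs, abs_of_pos hz.1]; exact hz.2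
    · exact intervalIntegrable_const
    · refine Eventually.of_forall fun z hz x _ => ?_
      have : HasDerivAt (fun x : ℝ => z * x) z x := by simpa using (hasDerivAt_id x).const_mul z
      exact this.cos.const_mul _
  -- The integrand is the `z`-derivative of `(1 - z²)^(k+1) sin(zρ) / (2(k+1))`, which vanishes at
  -- both endpoints.
  have h2 : ∫ z in (0 : ℝ)..1, ((1 - z ^ 2) ^ k * (-Real.sin (z * ρ) * z)
      + (ρ / (2 * (k + 1))) * ((1 - z ^ 2) ^ (k + 1) * Real.cos (z * ρ))) = 0 := by
    rw [intervalIntegral.integral_eq_sub_of_hasDerivAt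
      (f := fun z : ℝ => (1 - z ^ 2) ^ (k + 1) / (2 * (k + 1)) * Real.sin (z * ρ))]
    · simp
    · intro z _
      have e1 : HasDerivAt (fun z : ℝ => z * ρ) ρ z := by
        simpa using (hasDerivAt_id z).mul_const ρ
      have e2 : HasDerivAt (fun z : ℝ => (1 - z ^ 2) ^ (k + 1) / (2 * ((k : ℝ) + 1)))
          (-(z * (1 - z ^ 2) ^ k)) z := by
        convert! ((((hasDerivAt_id z).pow 2).const_sub 1).pow (k + 1)).div_const
          (2 * ((k : ℝ) + 1)) using 1
        have : (k : ℝ) + 1 ≠ 0 := by positivity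
        simp
        field_simp
      convert! e2.mul e1.sin using 1
      ring
    · exact Continuous.intervalIntegrable (by fun_prop) _ _
  rw [intervalIntegral.integral_add (Continuous.intervalIntegrable (by fun_prop) _ _)
    (Continuous.intervalIntegrable (by fun_prop) _ _), intervalIntegral.integral_const_mul] at h2
  convert! h1 using 1
  rw [← besselKernel] at h2
  linarith

lemma besselKernel_zero (ρ : ℝ) : besselKernel 0 ρ = Real.sinc ρ := by
  by_cases h : ρ = 0
  · simp [besselKernel, h]
  · rw [Real.sinc_of_ne_zero h]
    simp only [besselKernel, pow_zero, one_mul]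
    rw [intervalIntegral.integral_comp_mul_right (fun x => Real.cos x) h]
    simp [div_eq_inv_mul]

/-- The chain rule for an even function of the norm with derivative `ρ m(ρ)`. -/
lemma hasFDerivAt_comp_norm {h m : ℝ → ℝ} (hd : ∀ ρ, HasDerivAt h (ρ * m ρ) ρ) (x : E3) :
    HasFDerivAt (fun x : E3 => h ‖x‖) (m ‖x‖ • innerSL ℝ x) x := by
  by_cases hx : x = 0
  · subst hx
    have h0 : HasDerivAt h 0 ‖(0 : E3)‖ := by simpa using hd 0
    have h1 := h0.isLittleO
    have h2 := h1.comp_tendsto (k := fun y : E3 => ‖y‖) (l' := 𝓝 0)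
      (by simpa using (continuous_norm (E := E3)).tendsto 0)
    refine HasFDerivAt.of_isLittleO ?_
    simp only [map_zero, smul_zero, zero_apply, sub_zero]
    refine Asymptotics.IsLittleO.trans_isBigO (g := fun y : E3 => ‖y‖) ?_
      (Asymptotics.isBigO_refl _ _).norm_left
    simpa [Function.comp_def] using h2
  · have hn : HasFDerivAt (fun x : E3 => ‖x‖) (‖x‖⁻¹ • innerSL ℝ x) x := by
      have h1 := (hasStrictFDerivAt_norm_sq x).hasFDerivAt.sqrt (by simpa using hx)
      have h0 : ‖x‖ ≠ 0 := by simpa using hx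
      simp only [Real.sqrt_sq (norm_nonneg _)] at h1
      convert! h1 using 1
      ext y
      simp
      field_simp
    convert! (hd ‖x‖).comp_hasFDerivAt x hn using 1
    have h0 : ‖x‖ ≠ 0 := by simpa using hx
    rw [smul_smul]
    congr 1
    field_simp

/-- The gradient of the `k`-th kernel at `‖x‖` is the `(k+1)`-st kernel times a linear function of
`x`, so the family is closed under differentiation. Induction on the order, for all `k` at once,
reduces everything to the uniform bound by one. -/
lemma besselKernel_norm_regular (n : ℕ) : ∀ k, ContDiff ℝ n (fun x : E3 => besselKernel k ‖x‖) ∧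
    ∃ (C : ℝ) (j : ℕ), 0 ≤ C ∧ ∀ i ≤ n, ∀ x : E3,
      ‖iteratedFDeriv ℝ i (fun x : E3 => besselKernel k ‖x‖) x‖ ≤ C * (1 + ‖x‖) ^ j := by
  induction n with
  | zero =>
    intro k
    refine ⟨?_, 1, 0, zero_le_one, ?_⟩
    · rw [Nat.cast_zero, contDiff_zero]
      have : Continuous (besselKernel k) :=
        continuous_iff_continuousAt.2 fun ρ => (hasDerivAt_besselKernel k ρ).continuousAt
      exact this.comp continuous_norm
    · intro i hi x
      obtain rfl : i = 0 := by omega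
      simpa using abs_besselKernel_le k ‖x‖
  | succ n ih =>
    intro k
    obtain ⟨h1, C, j, hC, h2⟩ := ih (k + 1)
    have hd : ∀ x : E3, HasFDerivAt (fun x : E3 => besselKernel k ‖x‖)
        (besselKernel (k + 1) ‖x‖ • ((-(1 / (2 * ((k : ℝ) + 1)))) • innerSL ℝ x)) x := by
      intro x
      have := hasFDerivAt_comp_norm (h := besselKernel k)
        (m := fun ρ => -(1 / (2 * ((k : ℝ) + 1))) * besselKernel (k + 1) ρ)
        (fun ρ => by convert! hasDerivAt_besselKernel k ρ using 1; ring) x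
      convert! this using 1
      rw [smul_smul, mul_comm]
    have hf : fderiv ℝ (fun x : E3 => besselKernel k ‖x‖) = fun x =>
        besselKernel (k + 1) ‖x‖ • ((-(1 / (2 * ((k : ℝ) + 1)))) • innerSL ℝ x) :=
      funext fun x => (hd x).fderiv
    set L : E3 → (E3 →L[ℝ] ℝ) := fun x => (-(1 / (2 * ((k : ℝ) + 1)))) • innerSL ℝ x with hL
    have hLt : L.HasTemperateGrowth := by
      have : L = ⇑((-(1 / (2 * ((k : ℝ) + 1)))) • (innerSL ℝ : E3 →L[ℝ] E3 →L[ℝ] ℝ)) := by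
        ext x; simp [hL]
      rw [this]
      exact ContinuousLinearMap.hasTemperateGrowth _
    obtain ⟨j', C', hC', hL'⟩ := hLt.norm_iteratedFDeriv_le_uniform n
    have hcd : ContDiff ℝ (n : WithTop ℕ∞) (fderiv ℝ (fun x : E3 => besselKernel k ‖x‖)) := by
      rw [hf]
      exact h1.smul (hLt.1.of_le (mod_cast le_top))
    refine ⟨?_, ?_⟩
    · rw [Nat.cast_add, Nat.cast_one, contDiff_succ_iff_fderiv]
      exact ⟨fun x => (hd x).differentiableAt, by simp, hcd⟩
    · refine ⟨1 + 2 ^ n * (C * C'), j + j', by positivity, ?_⟩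
      intro i hi x
      have hone : 1 ≤ (1 + ‖x‖) ^ (j + j') := one_le_pow₀ (by linarith [norm_nonneg x])
      rcases i with _ | i
      · simp only [norm_iteratedFDeriv_zero]
        have := abs_besselKernel_le k ‖x‖
        rw [Real.norm_eq_abs]
        have h3 : 0 ≤ 2 ^ n * (C * C') := by positivity
        nlinarith
      · have hi' : i ≤ n := by omega
        rw [iteratedFDeriv_succ_eq_comp_right]
        simp only [Function.comp_apply, LinearIsometryEquiv.norm_map]
        rw [hf]
        refine (norm_iteratedFDeriv_smul_le (h1.of_le (mod_cast hi'))
          (hLt.1.of_le (mod_cast le_top)) x (le_refl (i : WithTop ℕ∞))).trans ?_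
        calc _ ≤ ∑ l ∈ Finset.range (i + 1), (i.choose l : ℝ) * (C * (1 + ‖x‖) ^ j) *
                (C' * (1 + ‖x‖) ^ j') := by
              refine Finset.sum_le_sum fun l hl => ?_
              have hl' : l ≤ i := by simpa [Nat.lt_succ_iff] using hl
              gcongr
              · exact h2 l (by omega) x
              · exact hL' (i - l) (by omega) x
          _ = 2 ^ i * (C * C') * (1 + ‖x‖) ^ (j + j') := by
              rw [← Finset.sum_mul, ← Finset.sum_mul, ← Nat.cast_sum, Nat.sum_range_choose, pow_add]
              push_cast
              ring
          _ ≤ _ := by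
              gcongr
              have : (2 : ℝ) ^ i ≤ 2 ^ n := pow_le_pow_right₀ (by norm_num) hi'
              have h4 := mul_le_mul_of_nonneg_right this (mul_nonneg hC hC')
              linarith

lemma besselKernel_norm_hasTemperateGrowth (k : ℕ) :
    (fun x : E3 => besselKernel k ‖x‖).HasTemperateGrowth := by
  refine ⟨contDiff_infty.2 fun n => (besselKernel_norm_regular n k).1, fun n => ?_⟩
  obtain ⟨-, C, j, -, h⟩ := besselKernel_norm_regular n k
  exact ⟨j, C, h n le_rfl⟩

lemma cos_norm_hasTemperateGrowth : (fun x : E3 => Real.cos ‖x‖).HasTemperateGrowth := by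
  have hd : ∀ x : E3, HasFDerivAt (fun x : E3 => Real.cos ‖x‖)
      ((-besselKernel 0 ‖x‖) • innerSL ℝ x) x := fun x =>
    hasFDerivAt_comp_norm (h := Real.cos) (m := fun ρ => -besselKernel 0 ρ) (fun ρ => by
      convert! Real.hasDerivAt_cos ρ using 1
      rw [besselKernel_zero]
      by_cases h : ρ = 0
      · simp [h]
      · rw [Real.sinc_of_ne_zero h]; field_simp) x
  refine Function.HasTemperateGrowth.of_fderiv (k := 0) (C := 1) ?_
    (fun x => (hd x).differentiableAt) (fun x => by simpa using Real.abs_cos_le_one _)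
  rw [show fderiv ℝ (fun x : E3 => Real.cos ‖x‖) = fun x : E3 =>
    (-besselKernel 0 ‖x‖) • innerSL ℝ x from funext fun x => (hd x).fderiv]
  exact (besselKernel_norm_hasTemperateGrowth 0).neg.smul
    ((innerSL ℝ : E3 →L[ℝ] E3 →L[ℝ] ℝ).hasTemperateGrowth)

/-- Dilating `x` by `2πt` only produces `|t|`; evenness restores the sign. -/
lemma comp_dilation_hasTemperateGrowth {h : ℝ → ℝ} (he : ∀ ρ, h (-ρ) = h ρ)
    (hh : (fun x : E3 => h ‖x‖).HasTemperateGrowth) (t : ℝ) :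
    (fun ξ : E3 => h (t * (2 * Real.pi * ‖ξ‖))).HasTemperateGrowth := by
  have h1 := hh.comp (((2 * Real.pi * t) • ContinuousLinearMap.id ℝ E3).hasTemperateGrowth)
  convert! h1 using 1
  ext ξ
  have habs : ∀ ρ, h |ρ| = h ρ := fun ρ => by
    rcases abs_choice ρ with h | h <;> rw [h]
    exact he ρ
  rw [← habs]
  simp only [Function.comp_apply, smul_apply, ContinuousLinearMap.id_apply,
    norm_smul, Real.norm_eq_abs, abs_mul, abs_norm]
  congr 1
  ring

lemma cosSymbol_hasTemperateGrowth (t : ℝ) : (cosSymbol t).HasTemperateGrowth :=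
  Function.HasTemperateGrowth.comp Function.Complex.hasTemperateGrowth_ofReal
    (comp_dilation_hasTemperateGrowth Real.cos_neg cos_norm_hasTemperateGrowth t)

lemma sinSymbol_hasTemperateGrowth (t : ℝ) : (sinSymbol t).HasTemperateGrowth := by
  have h0 : (fun x : E3 => Real.sinc ‖x‖).HasTemperateGrowth := by
    simpa only [besselKernel_zero] using besselKernel_norm_hasTemperateGrowth 0
  exact Function.HasTemperateGrowth.comp Function.Complex.hasTemperateGrowth_ofReal ((Function.HasTemperateGrowth.const t).mul
    (comp_dilation_hasTemperateGrowth Real.sinc_neg h0 t))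

/-! ### Radial profiles -/

/-- A smooth function on the line which vanishes outside `[α, β]`. -/
structure IsProfile (α β : ℝ) (ϕ : ℝ → ℝ) : Prop where
  smooth : ContDiff ℝ (⊤ : ℕ∞) ϕ
  eq_zero : ∀ r, r ∉ Set.Icc α β → ϕ r = 0

namespace IsProfile

variable {α β : ℝ} {ϕ : ℝ → ℝ}

lemma mono (h : IsProfile α β ϕ) {α' β' : ℝ} (hα : α' ≤ α) (hβ : β ≤ β') : IsProfile α' β' ϕ :=
  ⟨h.smooth, fun r hr => h.eq_zero r fun hr' => hr ⟨hα.trans hr'.1, hr'.2.trans hβ⟩⟩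

lemma continuous (h : IsProfile α β ϕ) : Continuous ϕ := h.smooth.continuous

lemma differentiable (h : IsProfile α β ϕ) : Differentiable ℝ ϕ :=
  h.smooth.differentiable (by simp)

lemma hasDerivAt (h : IsProfile α β ϕ) (r : ℝ) : HasDerivAt ϕ (deriv ϕ r) r :=
  (h.differentiable r).hasDerivAt

lemma hasCompactSupport (h : IsProfile α β ϕ) : HasCompactSupport ϕ :=
  HasCompactSupport.intro isCompact_Icc h.eq_zero

lemma eventuallyEq_zero (h : IsProfile α β ϕ) {r : ℝ} (hr : r ∉ Set.Icc α β) :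
    ϕ =ᶠ[𝓝 r] 0 := by
  filter_upwards [isClosed_Icc.isOpen_compl.mem_nhds hr] with s hs using h.eq_zero s hs

lemma deriv (h : IsProfile α β ϕ) : IsProfile α β (deriv ϕ) := by
  refine ⟨(contDiff_infty_iff_deriv.1 h.smooth).2, fun r hr => ?_⟩
  rw [(h.eventuallyEq_zero hr).deriv_eq]
  simp

lemma add {ψ : ℝ → ℝ} (h : IsProfile α β ϕ) (h' : IsProfile α β ψ) :
    IsProfile α β (fun r => ϕ r + ψ r) :=
  ⟨h.smooth.add h'.smooth, fun r hr => by rw [h.eq_zero r hr, h'.eq_zero r hr, add_zero]⟩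

lemma sub {ψ : ℝ → ℝ} (h : IsProfile α β ϕ) (h' : IsProfile α β ψ) :
    IsProfile α β (fun r => ϕ r - ψ r) :=
  ⟨h.smooth.sub h'.smooth, fun r hr => by rw [h.eq_zero r hr, h'.eq_zero r hr, sub_zero]⟩

lemma const_mul (h : IsProfile α β ϕ) (c : ℝ) : IsProfile α β (fun r => c * ϕ r) :=
  ⟨contDiff_const.mul h.smooth, fun r hr => by rw [h.eq_zero r hr, mul_zero]⟩

lemma id_mul (h : IsProfile α β ϕ) : IsProfile α β (fun r => r * ϕ r) :=
  ⟨contDiff_id.mul h.smooth, fun r hr => by rw [h.eq_zero r hr, mul_zero]⟩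

lemma comp_sub (h : IsProfile α β ϕ) (s : ℝ) : IsProfile (α + s) (β + s) (fun r => ϕ (r - s)) :=
  ⟨h.smooth.comp (contDiff_id.sub contDiff_const), fun r hr => h.eq_zero _ fun hr' =>
    hr ⟨by linarith [hr'.1], by linarith [hr'.2]⟩⟩

lemma div_pow (h : IsProfile α β ϕ) (hα : 0 < α) (n : ℕ) :
    IsProfile α β (fun r => ϕ r / r ^ n) := by
  refine ⟨contDiff_iff_contDiffAt.2 fun r => ?_, fun r hr => by rw [h.eq_zero r hr, zero_div]⟩
  by_cases hr : r = 0
  · subst hr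
    have h0 := h.eventuallyEq_zero (r := 0) fun h => absurd h.1 (by linarith)
    refine (contDiffAt_const (c := (0 : ℝ))).congr_of_eventuallyEq ?_
    filter_upwards [h0] with s hs
    simp [hs]
  · exact h.smooth.contDiffAt.div (contDiffAt_id.pow n) (pow_ne_zero _ hr)

lemma exists_bound (h : IsProfile α β ϕ) : ∃ M, 0 ≤ M ∧ ∀ r, |ϕ r| ≤ M := by
  obtain ⟨M, hM⟩ := h.hasCompactSupport.exists_bound_of_continuous h.continuous
  exact ⟨M, (abs_nonneg _).trans (hM 0), hM⟩

lemma contDiff_comp_norm (h : IsProfile α β ϕ) (hα : 0 < α) :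
    ContDiff ℝ (⊤ : ℕ∞) (fun x : E3 => ϕ ‖x‖) := by
  refine contDiff_iff_contDiffAt.2 fun x => ?_
  by_cases hx : x = 0
  · subst hx
    have h0 := h.eventuallyEq_zero (r := ‖(0 : E3)‖) fun h => absurd h.1 (by simpa using hα)
    refine (contDiffAt_const (c := (0 : ℝ))).congr_of_eventuallyEq ?_
    exact (continuous_norm.tendsto (0 : E3)).eventually h0
  · exact h.smooth.contDiffAt.comp x (contDiffAt_norm ℝ hx)

lemma tsupport_comp_norm_subset (h : IsProfile α β ϕ) :
    tsupport (fun x : E3 => ϕ ‖x‖) ⊆ {x | α ≤ ‖x‖ ∧ ‖x‖ ≤ β} := by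
  refine closure_minimal (fun x hx => ?_) ?_
  · by_contra hx'
    exact hx (h.eq_zero _ hx')
  · exact (isClosed_le continuous_const continuous_norm).inter
      (isClosed_le continuous_norm continuous_const)

lemma hasCompactSupport_comp_norm (h : IsProfile α β ϕ) :
    HasCompactSupport (fun x : E3 => ϕ ‖x‖) := by
  refine HasCompactSupport.intro (isCompact_closedBall (0 : E3) β) fun x hx => h.eq_zero _ fun h' =>
    hx (by simpa using h'.2)

end IsProfile

/-! ### Radial test functions and their Laplacian -/

open Classical in
/-- The test function `x ↦ ϕ(|x|) / |x|`, for a profile `ϕ` supported away from the origin. -/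
def radialTest (ϕ : ℝ → ℝ) : 𝓢(E3, ℂ) :=
  -- The default value zero makes the construction total, so families of profiles can be
  -- differentiated in a parameter without carrying proofs along.
  if h : HasCompactSupport (fun x : E3 => ((ϕ ‖x‖ / ‖x‖ : ℝ) : ℂ)) ∧
    ContDiff ℝ (⊤ : ℕ∞) (fun x : E3 => ((ϕ ‖x‖ / ‖x‖ : ℝ) : ℂ)) then h.1.toSchwartzMap h.2 else 0

section radialTest

variable {α β : ℝ} {ϕ : ℝ → ℝ}

lemma radialTest_apply (h : IsProfile α β ϕ) (hα : 0 < α) (x : E3) :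
    radialTest ϕ x = ((ϕ ‖x‖ / ‖x‖ : ℝ) : ℂ) := by
  have h1 := h.div_pow hα 1
  simp only [pow_one] at h1
  have h2 : HasCompactSupport (fun x : E3 => ((ϕ ‖x‖ / ‖x‖ : ℝ) : ℂ)) ∧
      ContDiff ℝ (⊤ : ℕ∞) (fun x : E3 => ((ϕ ‖x‖ / ‖x‖ : ℝ) : ℂ)) :=
    ⟨h1.hasCompactSupport_comp_norm.comp_left (g := Complex.ofReal) Complex.ofReal_zero,
      Complex.ofRealCLM.contDiff.comp (h1.contDiff_comp_norm hα)⟩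
  rw [radialTest, dif_pos h2]
  rfl

lemma hasFDerivAt_comp_norm_of_ne {g : ℝ → ℝ} {g' : ℝ} {x : E3} (hx : x ≠ 0)
    (hg : HasDerivAt g g' ‖x‖) :
    HasFDerivAt (fun x : E3 => g ‖x‖) ((g' / ‖x‖) • innerSL ℝ x) x := by
  have h0 : ‖x‖ ≠ 0 := by simpa using hx
  have hn : HasFDerivAt (fun x : E3 => ‖x‖) (‖x‖⁻¹ • innerSL ℝ x) x := by
    have h1 := (hasStrictFDerivAt_norm_sq x).hasFDerivAt.sqrt (by simpa using hx)
    simp only [Real.sqrt_sq (norm_nonneg _)] at h1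
    convert! h1 using 1
    ext y
    simp
    field_simp
  convert! HasDerivAt.comp_hasFDerivAt x hg hn using 1
  rw [smul_smul, div_eq_mul_inv]

/-- The Laplacian of `v(|x|)/|x|` in three dimensions is `v''(|x|)/|x|`. -/
lemma laplacian_radial {f : E3 → ℝ} {v v₁ : ℝ → ℝ} {v₂ : ℝ} {x : E3} (hx : x ≠ 0)
    (hf : f =ᶠ[𝓝 x] fun y => v ‖y‖ / ‖y‖)
    (h₁ : ∀ᶠ ρ in 𝓝 ‖x‖, HasDerivAt v (v₁ ρ) ρ) (h₂ : HasDerivAt v₁ v₂ ‖x‖) :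
    Δ f x = v₂ / ‖x‖ := by
  have h0 : ‖x‖ ≠ 0 := by simpa using hx
  set m : ℝ → ℝ := fun ρ => v₁ ρ / ρ ^ 2 - v ρ / ρ ^ 3 with hm
  have hfd : fderiv ℝ f =ᶠ[𝓝 x] fun y => m ‖y‖ • innerSL ℝ y := by
    have e1 : ∀ᶠ y in 𝓝 x, HasDerivAt v (v₁ ‖y‖) ‖y‖ := (continuous_norm.tendsto x).eventually h₁
    have e2 : ∀ᶠ y in 𝓝 x, y ≠ 0 := isOpen_ne.mem_nhds hx
    filter_upwards [hf.fderiv (𝕜 := ℝ), e1, e2] with y hy hy1 hy2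
    have hy0 : ‖y‖ ≠ 0 := by simpa using hy2
    rw [hy, (hasFDerivAt_comp_norm_of_ne (g := fun ρ => v ρ / ρ) hy2
      (hy1.div (hasDerivAt_id _) hy0)).fderiv]
    congr 1
    simp only [hm]
    field_simp
  have hm' : HasDerivAt m (v₂ / ‖x‖ ^ 2 - 3 * v₁ ‖x‖ / ‖x‖ ^ 3 + 3 * v ‖x‖ / ‖x‖ ^ 4) ‖x‖ := by
    convert! (h₂.div ((hasDerivAt_id _).pow 2) (pow_ne_zero 2 h0)).sub
      (h₁.self_of_nhds.div ((hasDerivAt_id _).pow 3) (pow_ne_zero 3 h0)) using 1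
    simp
    field_simp
    ring
  have hd := (hasFDerivAt_comp_norm_of_ne hx hm').smul
    ((innerSL ℝ : E3 →L[ℝ] E3 →L[ℝ] ℝ).hasFDerivAt (x := x))
  rw [InnerProductSpace.laplacian_eq_iteratedFDeriv_orthonormalBasis f
    (EuclideanSpace.basisFun (Fin 3) ℝ)]
  simp only [iteratedFDeriv_two_apply, hfd.fderiv_eq]
  have hd' : fderiv ℝ (fun y : E3 => m ‖y‖ • innerSL ℝ y) x = _ := hd.fderiv
  rw [hd']
  have hsq : x 0 ^ 2 + x 1 ^ 2 + x 2 ^ 2 = ‖x‖ ^ 2 := by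
    rw [EuclideanSpace.norm_sq_eq, Fin.sum_univ_three]
    simp
  have hin : ∀ y z : E3, innerSL ℝ y z = inner ℝ y z := fun _ _ => rfl
  have hxi : ∀ i, inner ℝ x (EuclideanSpace.single i (1 : ℝ)) = x i := fun i => by
    simp [EuclideanSpace.inner_single_right]
  have hii : ∀ i : Fin 3, inner ℝ (EuclideanSpace.single i (1 : ℝ))
      (EuclideanSpace.single i (1 : ℝ)) = (1 : ℝ) := fun i => by simp
  simp only [Fin.sum_univ_three, EuclideanSpace.basisFun_apply, Matrix.cons_val_zero,
    Matrix.cons_val_one, add_apply, smul_apply, ContinuousLinearMap.smulRight_apply, hin, hxi, hii,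
    smul_eq_mul, hm]
  trans ((v₂ / ‖x‖ ^ 2 - 3 * v₁ ‖x‖ / ‖x‖ ^ 3 + 3 * v ‖x‖ / ‖x‖ ^ 4) / ‖x‖ *
    (x 0 ^ 2 + x 1 ^ 2 + x 2 ^ 2) + 3 * (v₁ ‖x‖ / ‖x‖ ^ 2 - v ‖x‖ / ‖x‖ ^ 3))
  · ring
  rw [hsq]
  field_simp
  ring

lemma laplacian_radialTest (h : IsProfile α β ϕ) (hα : 0 < α) :
    Δ (radialTest ϕ) = radialTest (deriv (deriv ϕ)) := by
  ext x
  rw [SchwartzMap.laplacian_apply, radialTest_apply h.deriv.deriv hα]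
  have hfun : (radialTest ϕ : E3 → ℂ) = Complex.ofRealCLM ∘ fun x : E3 => ϕ ‖x‖ / ‖x‖ :=
    funext fun x => radialTest_apply h hα x
  have h1 := h.div_pow hα 1
  simp only [pow_one] at h1
  have hc : ContDiff ℝ 2 fun x : E3 => ϕ ‖x‖ / ‖x‖ :=
    (h1.contDiff_comp_norm hα).of_le (WithTop.coe_le_coe.2 le_top)
  rw [hfun, hc.contDiffAt.laplacian_CLM_comp_left]
  simp only [Function.comp_apply, Complex.ofRealCLM_apply, Complex.ofReal_inj]
  by_cases hx : x = 0
  · subst hx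
    have h0 : (fun x : E3 => ϕ ‖x‖ / ‖x‖) =ᶠ[𝓝 0] fun _ => (0 : ℝ) := by
      have := h.eventuallyEq_zero (r := ‖(0 : E3)‖) fun h => absurd h.1 (by simpa using hα)
      filter_upwards [(continuous_norm.tendsto (0 : E3)).eventually this] with y hy
      simp [hy]
    rw [(InnerProductSpace.laplacian_congr_nhds h0).eq_of_nhds]
    simp
  · exact laplacian_radial hx Filter.EventuallyEq.rfl (Eventually.of_forall h.hasDerivAt)
      (h.deriv.hasDerivAt _)

/-- At fixed `ξ` this makes translation of the profile a harmonic oscillator of frequency `2π|ξ|`.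
-/
lemma fourier_radialTest_deriv_deriv (h : IsProfile α β ϕ) (hα : 0 < α) (ξ : E3) :
    𝓕 (radialTest (deriv (deriv ϕ))) ξ = -(2 * Real.pi * ‖ξ‖ : ℝ) ^ 2 * 𝓕 (radialTest ϕ) ξ := by
  rw [← laplacian_radialTest h hα, SchwartzMap.laplacian_eq_fourierMultiplierCLM,
    SchwartzMap.fourierMultiplierCLM_apply, FourierTransform.fourier_smul,
    FourierTransform.fourier_fourierInv_eq]
  have : (fun x : E3 => ‖x‖ ^ 2).HasTemperateGrowth := by fun_prop
  simp only [smul_apply, SchwartzMap.smulLeftCLM_apply_apply this]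
  simp
  ring

end radialTest

/-! ### Window averages, the profile form of the sine propagator -/

/-- The mean of `ϕ` over `[r - b, r + b]`, times `b`; this is the action of `sin(b√-Δ)/√-Δ` on
radial profiles. -/
def halfWindow (ϕ : ℝ → ℝ) (b r : ℝ) : ℝ := (1 / 2) * ∫ s in (r - b)..(r + b), ϕ s

section halfWindow

variable {α β : ℝ} {ϕ : ℝ → ℝ}

lemma hasDerivAt_integral_of_continuous (h : Continuous ϕ) (r : ℝ) :
    HasDerivAt (fun r => ∫ s in (0 : ℝ)..r, ϕ s) (ϕ r) r :=
  intervalIntegral.integral_hasDerivAt_right (h.intervalIntegrable _ _)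
    h.stronglyMeasurable.stronglyMeasurableAtFilter h.continuousAt

lemma halfWindow_eq (h : Continuous ϕ) (b r : ℝ) :
    halfWindow ϕ b r = (1 / 2) * ((∫ s in (0 : ℝ)..(r + b), ϕ s) - ∫ s in (0 : ℝ)..(r - b), ϕ s) := by
  rw [halfWindow, intervalIntegral.integral_interval_sub_left] <;>
  exact h.intervalIntegrable _ _

lemma halfWindow_neg (ϕ : ℝ → ℝ) (b r : ℝ) : halfWindow ϕ (-b) r = -halfWindow ϕ b r := by
  rw [halfWindow, halfWindow, intervalIntegral.integral_symm]
  simp only [sub_neg_eq_add, ← sub_eq_add_neg]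
  ring

lemma halfWindow_nonneg (h : ∀ r, 0 ≤ ϕ r) {b : ℝ} (hb : 0 ≤ b) (r : ℝ) : 0 ≤ halfWindow ϕ b r :=
  mul_nonneg (by norm_num) (intervalIntegral.integral_nonneg (by linarith) fun s _ => h s)

lemma hasDerivAt_halfWindow_left (h : Continuous ϕ) (b r : ℝ) :
    HasDerivAt (fun b => halfWindow ϕ b r) (1 / 2 * (ϕ (r + b) + ϕ (r - b))) b := by
  simp only [halfWindow_eq h]
  have h1 := (hasDerivAt_integral_of_continuous h (r + b)).comp b ((hasDerivAt_id b).const_add r)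
  have h2 := (hasDerivAt_integral_of_continuous h (r - b)).comp b ((hasDerivAt_id b).const_sub r)
  convert! (h1.sub h2).const_mul (1 / 2) using 1
  ring

lemma hasDerivAt_halfWindow_right (h : Continuous ϕ) (b r : ℝ) :
    HasDerivAt (halfWindow ϕ b) (1 / 2 * (ϕ (r + b) - ϕ (r - b))) r := by
  have e : halfWindow ϕ b = _ := funext fun r => halfWindow_eq h b r
  rw [e]
  have h1 := (hasDerivAt_integral_of_continuous h (r + b)).comp r ((hasDerivAt_id r).add_const b)
  have h2 := (hasDerivAt_integral_of_continuous h (r - b)).comp r ((hasDerivAt_id r).sub_const b)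
  convert! (h1.sub h2).const_mul (1 / 2) using 1
  ring

lemma IsProfile.halfWindow (h : IsProfile α β ϕ) (b : ℝ) :
    IsProfile (α - |b|) (β + |b|) (halfWindow ϕ b) := by
  refine ⟨?_, fun r hr => ?_⟩
  · rw [contDiff_infty_iff_deriv]
    refine ⟨fun r => (hasDerivAt_halfWindow_right h.continuous b r).differentiableAt, ?_⟩
    rw [show _root_.deriv (RadialWave.halfWindow ϕ b) = fun r => 1 / 2 * (ϕ (r + b) - ϕ (r - b)) from
      funext fun r => (hasDerivAt_halfWindow_right h.continuous b r).deriv]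
    exact contDiff_const.mul ((h.smooth.comp (contDiff_id.add contDiff_const)).sub
      (h.smooth.comp (contDiff_id.sub contDiff_const)))
  · rw [RadialWave.halfWindow, intervalIntegral.integral_congr (g := fun _ => 0), intervalIntegral.integral_zero,
      mul_zero]
    intro s hs
    refine h.eq_zero s fun hs' => hr ?_
    rw [Set.mem_uIcc] at hs
    have := abs_le.1 (le_refl |b|)
    constructor <;> rcases hs with hs | hs <;> linarith [hs'.1, hs'.2, hs.1, hs.2]

end halfWindow

/-! ### d'Alembert's formula for the Fourier multipliers -/

section Propagator

variable {α β : ℝ} {ϕ : ℝ → ℝ}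

lemma fourier_schwartz_apply (f : 𝓢(E3, ℂ)) (ξ : E3) :
    𝓕 f ξ = ∫ x, Real.fourierChar (-inner ℝ x ξ) • f x := by
  rw [SchwartzMap.fourier_coe, Real.fourier_eq]

/-- Differentiation under the Fourier transform of a family of radial test functions. -/
lemma hasDerivAt_fourier_radialTest {P P' : ℝ → ℝ → ℝ} {s₀ ε M : ℝ} (hε : 0 < ε) (hα : 0 < α)
    (hP : ∀ s ∈ Metric.ball s₀ ε, IsProfile α β (P s))
    (hP' : ∀ s ∈ Metric.ball s₀ ε, IsProfile α β (P' s))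
    (hM : ∀ s ∈ Metric.ball s₀ ε, ∀ r, |P' s r| ≤ M)
    (hd : ∀ s ∈ Metric.ball s₀ ε, ∀ r, HasDerivAt (fun s => P s r) (P' s r) s) (ξ : E3) :
    HasDerivAt (fun s => 𝓕 (radialTest (P s)) ξ) (𝓕 (radialTest (P' s₀)) ξ) s₀ := by
  have hs₀ := Metric.mem_ball_self (x := s₀) hε
  have hint : ∀ f : 𝓢(E3, ℂ), Integrable fun x => Real.fourierChar (-inner ℝ x ξ) • f x := fun f =>
    (Real.fourierIntegral_convergent_iff ξ).2 f.integrable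
  simp only [fourier_schwartz_apply]
  have hMn : 0 ≤ M := (abs_nonneg _).trans (hM s₀ hs₀ 0)
  refine (hasDerivAt_integral_of_dominated_loc_of_deriv_le
    (F := fun s x => Real.fourierChar (-inner ℝ x ξ) • radialTest (P s) x)
    (F' := fun s x => Real.fourierChar (-inner ℝ x ξ) • radialTest (P' s) x)
    (bound := (Metric.closedBall (0 : E3) β).indicator fun _ => M / α)
    (Metric.ball_mem_nhds s₀ hε) ?_ (hint _) (hint _).aestronglyMeasurable ?_ ?_ ?_).2
  · exact Eventually.of_forall fun s => (hint _).aestronglyMeasurable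
  · refine Eventually.of_forall fun x s hs => ?_
    rw [Circle.norm_smul, radialTest_apply (hP' s hs) hα]
    by_cases hx : ‖x‖ ∈ Set.Icc α β
    · rw [Set.indicator_of_mem (by simpa using hx.2), Complex.norm_real, Real.norm_eq_abs, abs_div,
        abs_norm]
      exact div_le_div₀ hMn (hM s hs _) hα hx.1
    · rw [(hP' s hs).eq_zero _ hx]
      simp only [zero_div, Complex.ofReal_zero, norm_zero]
      exact Set.indicator_nonneg (fun _ _ => by positivity) _
  · rw [integrable_indicator_iff Metric.isClosed_closedBall.measurableSet]
    exact integrableOn_const (measure_closedBall_lt_top.ne)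
  · refine Eventually.of_forall fun x s hs => ?_
    have h1 : HasDerivAt (fun s => ((P s ‖x‖ / ‖x‖ : ℝ) : ℂ)) ((P' s ‖x‖ / ‖x‖ : ℝ) : ℂ) s :=
      ((hd s hs ‖x‖).div_const _).ofReal_comp
    have h2 : (fun s => (radialTest (P s) x : ℂ)) =ᶠ[𝓝 s] fun s => ((P s ‖x‖ / ‖x‖ : ℝ) : ℂ) := by
      filter_upwards [Metric.isOpen_ball.mem_nhds hs] with s' hs'
      exact radialTest_apply (hP s' hs') hα x
    rw [radialTest_apply (hP' s hs) hα]
    exact (h1.congr_of_eventuallyEq h2).const_smul _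

/-- The condition on `s` says that the translated profile still avoids the origin; half the
remaining distance serves as margin for the neighbouring parameters. -/
lemma hasDerivAt_fourier_radialTest_comp_sub (h : IsProfile α β ϕ) {s : ℝ} (hs : -α < s) (ξ : E3) :
    HasDerivAt (fun s => 𝓕 (radialTest fun r => ϕ (r - s)) ξ)
      (-𝓕 (radialTest fun r => deriv ϕ (r - s)) ξ) s := by
  obtain ⟨M, hM0, hM⟩ := h.deriv.exists_bound
  set ε := (α + s) / 2 with hε
  have hneg : -𝓕 (radialTest fun r => deriv ϕ (r - s)) ξ =
      𝓕 (radialTest fun r => -1 * deriv ϕ (r - s)) ξ := by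
    have : radialTest (fun r => -1 * deriv ϕ (r - s)) = -radialTest fun r => deriv ϕ (r - s) := by
      ext x
      have h1 := h.deriv.comp_sub s
      rw [neg_apply, radialTest_apply h1 (by linarith),
        radialTest_apply (h1.const_mul (-1)) (by linarith)]
      push_cast
      ring
    rw [this, FourierTransform.fourier_neg, neg_apply]
  rw [hneg]
  refine hasDerivAt_fourier_radialTest (P := fun s r => ϕ (r - s)) (α := ε) (β := β + s + ε)
    (P' := fun s r => -1 * deriv ϕ (r - s))
    (M := M) (ε := ε) (by linarith) (by linarith) ?_ ?_ ?_ ?_ ξ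
  · intro s' hs'
    have := abs_lt.1 (Metric.mem_ball.1 hs')
    exact (h.comp_sub s').mono (by linarith [this.1]) (by linarith [this.2])
  · intro s' hs'
    have := abs_lt.1 (Metric.mem_ball.1 hs')
    exact ((h.deriv.comp_sub s').const_mul (-1)).mono (by linarith [this.1]) (by linarith [this.2])
  · intro s' _ r
    simpa using hM (r - s')
  · intro s' _ r
    have h1 := (h.hasDerivAt (r - s')).comp s' ((hasDerivAt_id s').const_sub r)
    convert! h1 using 1
    ring

/-- d'Alembert's formula for the harmonic oscillator. -/
lemma add_eq_two_mul_cos {y y₁ : ℝ → ℂ} {k c a : ℝ}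
    (h₀ : ∀ s, c < s → HasDerivAt y (y₁ s) s) (h₁ : ∀ s, c < s → HasDerivAt y₁ (-(k : ℂ) ^ 2 * y s) s)
    {b : ℝ} (hb : |b| < a - c) : y (a + b) + y (a - b) = 2 * Real.cos (k * b) * y a := by
  set I := Set.Ioo (-(a - c)) (a - c) with hI
  set g : ℝ → ℂ := fun b => y (a + b) + y (a - b) - 2 * Real.cos (k * b) * y a with hg
  set g₁ : ℝ → ℂ := fun b => y₁ (a + b) - y₁ (a - b) + 2 * k * Real.sin (k * b) * y a with hg₁
  have hac : 0 < a - c := (abs_nonneg b).trans_lt hb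
  have h0I : (0 : ℝ) ∈ I := ⟨by linarith, hac⟩
  have hbI : b ∈ I := abs_lt.1 hb
  have hcos : ∀ b : ℝ, HasDerivAt (fun b : ℝ => ((Real.cos (k * b) : ℝ) : ℂ))
      (-(k : ℂ) * Real.sin (k * b)) b := fun b => by
    have := (((hasDerivAt_id b).const_mul k).cos).ofReal_comp
    convert! this using 1
    push_cast; simp; ring
  have hsin : ∀ b : ℝ, HasDerivAt (fun b : ℝ => ((Real.sin (k * b) : ℝ) : ℂ))
      ((k : ℂ) * Real.cos (k * b)) b := fun b => by
    have := (((hasDerivAt_id b).const_mul k).sin).ofReal_comp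
    convert! this using 1
    push_cast; simp; ring
  have hgd : ∀ b ∈ I, HasDerivAt g (g₁ b) b := by
    intro b hb
    have e1 := (h₀ (a + b) (by linarith [hb.1])).scomp b ((hasDerivAt_id b).const_add a)
    have e2 := (h₀ (a - b) (by linarith [hb.2])).scomp b ((hasDerivAt_id b).const_sub a)
    convert! (e1.add e2).sub (((hcos b).const_mul 2).mul_const (y a)) using 1
    simp [hg₁]; ring
  have hgd₁ : ∀ b ∈ I, HasDerivAt g₁ (-(k : ℂ) ^ 2 * g b) b := by
    intro b hb
    have e1 := (h₁ (a + b) (by linarith [hb.1])).scomp b ((hasDerivAt_id b).const_add a)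
    have e2 := (h₁ (a - b) (by linarith [hb.2])).scomp b ((hasDerivAt_id b).const_sub a)
    convert! (e1.sub e2).add (((hsin b).const_mul (2 * (k : ℂ))).mul_const (y a)) using 1
    simp [hg]; ring
  -- The vector `(g₁, k g)` rotated back by the angle `k b` is constant, and it vanishes at `b = 0`.
  -- This yields `g₁ = 0` without dividing by `k`, so `k = 0` needs no separate case.
  have hp : ∀ b ∈ I, HasDerivAt (fun b => g₁ b * Real.cos (k * b) + k * g b * Real.sin (k * b)) 0 b := by
    intro b hb
    convert! ((hgd₁ b hb).mul (hcos b)).add (((hgd b hb).const_mul (k : ℂ)).mul (hsin b)) using 1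
    ring
  have hq : ∀ b ∈ I, HasDerivAt (fun b => g₁ b * Real.sin (k * b) - k * g b * Real.cos (k * b)) 0 b := by
    intro b hb
    convert! ((hgd₁ b hb).mul (hsin b)).sub (((hgd b hb).const_mul (k : ℂ)).mul (hcos b)) using 1
    ring
  have hconst : ∀ {f : ℝ → ℂ}, (∀ b ∈ I, HasDerivAt f 0 b) → ∀ b ∈ I, f b = f 0 := by
    intro f hf b hb
    exact isOpen_Ioo.is_const_of_deriv_eq_zero isPreconnected_Ioo
      (fun x hx => (hf x hx).differentiableAt.differentiableWithinAt)
      (fun x hx => (hf x hx).deriv) hb h0I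
  have hg0 : g 0 = 0 := by simp [hg]; ring
  have hg10 : g₁ 0 = 0 := by simp [hg₁]
  have hgz : ∀ b ∈ I, HasDerivAt g 0 b := by
    intro b hb
    have ep := hconst hp b hb
    have eq := hconst hq b hb
    simp only [hg0, hg10, zero_mul, mul_zero, add_zero, sub_zero] at ep eq
    have hcs : ((Real.cos (k * b) : ℝ) : ℂ) ^ 2 + ((Real.sin (k * b) : ℝ) : ℂ) ^ 2 = 1 := by
      exact_mod_cast Real.cos_sq_add_sin_sq (k * b)
    have : g₁ b = 0 := by
      linear_combination (Real.cos (k * b) : ℂ) * ep + (Real.sin (k * b) : ℂ) * eq - g₁ b * hcs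
    rw [← this]
    exact hgd b hb
  have := hconst hgz b hbI
  rw [hg0] at this
  exact sub_eq_zero.1 this

/-- `fourier_radialTest_deriv_deriv` supplies the oscillator equation in the translation parameter,
valid on `s > -α`; `add_eq_two_mul_cos` solves it. -/
lemma fourier_radialTest_cos (h : IsProfile α β ϕ) {b : ℝ} (hb : |b| < α) (ξ : E3) :
    𝓕 (radialTest fun r => ϕ (r - b)) ξ + 𝓕 (radialTest fun r => ϕ (r + b)) ξ =
      2 * Real.cos (b * (2 * Real.pi * ‖ξ‖)) * 𝓕 (radialTest ϕ) ξ := by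
  have := add_eq_two_mul_cos (y := fun s => 𝓕 (radialTest fun r => ϕ (r - s)) ξ)
    (y₁ := fun s => -𝓕 (radialTest fun r => deriv ϕ (r - s)) ξ) (k := 2 * Real.pi * ‖ξ‖) (c := -α)
    (a := 0) (fun s hs => hasDerivAt_fourier_radialTest_comp_sub h hs ξ) (fun s hs => by
      have h1 := (hasDerivAt_fourier_radialTest_comp_sub h.deriv hs ξ).neg
      have h2 := fourier_radialTest_deriv_deriv (h.comp_sub s) (by linarith) ξ
      have hds : ∀ f : ℝ → ℝ, deriv (fun r => f (r - s)) = fun r => deriv f (r - s) :=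
        fun f => funext fun r => deriv_comp_sub_const ..
      rw [hds, hds] at h2
      rw [h2] at h1
      convert! h1 using 1
      push_cast
      ring) (b := b) (by simpa using hb)
  simp only [zero_add, zero_sub, sub_neg_eq_add, sub_zero] at this
  rw [this, mul_comm b]

/-- Both sides vanish at `b = 0` and have the same `b`-derivative, by the cosine formula. -/
lemma fourier_radialTest_sin (h : IsProfile α β ϕ) {b : ℝ} (hb : |b| < α) (ξ : E3) :
    𝓕 (radialTest (halfWindow ϕ b)) ξ =
      (b * Real.sinc (b * (2 * Real.pi * ‖ξ‖)) : ℝ) * 𝓕 (radialTest ϕ) ξ := by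
  have hα : 0 < α := (abs_nonneg b).trans_lt hb
  set k := 2 * Real.pi * ‖ξ‖ with hk
  set I := Set.Ioo (-α) α
  have hbI : b ∈ I := abs_lt.1 hb
  have h0I : (0 : ℝ) ∈ I := ⟨by linarith, hα⟩
  have hZ : ∀ b ∈ I, HasDerivAt (fun b => 𝓕 (radialTest (halfWindow ϕ b)) ξ)
      (Real.cos (k * b) * 𝓕 (radialTest ϕ) ξ) b := by
    intro b hb'
    have hb : |b| < α := abs_lt.2 hb'
    obtain ⟨M, hM0, hM⟩ := h.exists_bound
    set ε := (α - |b|) / 2 with hε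
    have hball : ∀ b' ∈ Metric.ball b ε, |b'| ≤ |b| + ε := fun b' hb' => by
      have h1 : |b' - b| < ε := hb'
      have h2 := abs_sub_abs_le_abs_sub b' b
      linarith
    have hprof : ∀ b' ∈ Metric.ball b ε, IsProfile ε (β + |b| + ε)
        (fun r => 1 / 2 * (ϕ (r + b') + ϕ (r - b'))) := fun b' hb' => by
      have h1 := hball b' hb'
      have h2 := abs_le.1 (le_refl |b'|)
      have e1 := (h.comp_sub (-b')).mono (α' := ε) (β' := β + |b| + ε) (by linarith) (by linarith)
      have e2 := (h.comp_sub b').mono (α' := ε) (β' := β + |b| + ε) (by linarith) (by linarith)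
      simp only [sub_neg_eq_add] at e1
      exact (e1.add e2).const_mul _
    have hd := hasDerivAt_fourier_radialTest (P := fun b => halfWindow ϕ b)
      (P' := fun b r => 1 / 2 * (ϕ (r + b) + ϕ (r - b))) (s₀ := b) (ε := ε) (α := ε)
      (β := β + |b| + ε) (M := M) (by linarith) (by linarith)
      (fun b' hb' => (h.halfWindow b').mono (by linarith [hball b' hb']) (by linarith [hball b' hb']))
      hprof (fun b' _ r => by
        have e1 := abs_le.1 (hM (r + b'))
        have e2 := abs_le.1 (hM (r - b'))
        rw [abs_le]
        constructor <;> linarith [e1.1, e1.2, e2.1, e2.2])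
      (fun b' _ r => hasDerivAt_halfWindow_left h.continuous b' r) ξ
    convert! hd using 1
    have hcos := fourier_radialTest_cos h hb ξ
    have hsum : radialTest (fun r => 1 / 2 * (ϕ (r + b) + ϕ (r - b))) = (1 / 2 : ℂ) •
        (radialTest (fun r => ϕ (r - b)) + radialTest fun r => ϕ (r + b)) := by
      ext x
      have h2 := abs_le.1 (le_refl |b|)
      have e1 := h.comp_sub (-b)
      simp only [sub_neg_eq_add] at e1
      rw [smul_apply, add_apply, radialTest_apply (hprof b (Metric.mem_ball_self (by linarith)))
        (by linarith), radialTest_apply (h.comp_sub b) (by linarith), radialTest_apply e1 (by linarith)]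
      push_cast
      simp
      ring
    rw [hsum, FourierTransform.fourier_smul, FourierTransform.fourier_add, smul_apply, add_apply,
      hcos, ← hk, mul_comm b]
    simp
    ring
  have hS : ∀ b : ℝ, HasDerivAt (fun b : ℝ => ((b * Real.sinc (b * k) : ℝ) : ℂ) * 𝓕 (radialTest ϕ) ξ)
      (Real.cos (k * b) * 𝓕 (radialTest ϕ) ξ) b := by
    intro b
    refine HasDerivAt.mul_const ?_ _
    refine HasDerivAt.ofReal_comp (f := fun b => b * Real.sinc (b * k)) ?_
    by_cases hk0 : k = 0
    · simp only [hk0, mul_zero, zero_mul, Real.sinc_zero, mul_one, Real.cos_zero]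
      exact hasDerivAt_id b
    · have : (fun b => b * Real.sinc (b * k)) = fun b => Real.sin (k * b) / k := by
        ext b
        by_cases hb : b = 0
        · simp [hb]
        · rw [Real.sinc_of_ne_zero (by positivity), mul_comm k]
          field_simp
      rw [this]
      have h1 := ((hasDerivAt_id b).const_mul k).sin.div_const k
      convert! h1 using 1
      simp
      field_simp
  have hconst := isOpen_Ioo.is_const_of_deriv_eq_zero (f := fun b =>
      𝓕 (radialTest (halfWindow ϕ b)) ξ - ((b * Real.sinc (b * k) : ℝ) : ℂ) * 𝓕 (radialTest ϕ) ξ)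
      (s := I) isPreconnected_Ioo
      (fun x hx => ((hZ x hx).sub (hS x)).differentiableAt.differentiableWithinAt)
      (fun x hx => ((hZ x hx).sub (hS x)).deriv.trans (sub_self _)) hbI h0I
  have hz : radialTest (halfWindow ϕ 0) = 0 := by
    ext x
    have h0 := h.halfWindow 0
    rw [radialTest_apply h0 (by simpa using hα)]
    simp [halfWindow]
  simp only [hz, zero_mul, Complex.ofReal_zero, sub_zero] at hconst
  rw [show 𝓕 (0 : 𝓢(E3, ℂ)) = 0 from by simp] at hconst
  simpa [sub_eq_zero] using hconst

/-- A function whose Fourier transform is an even symbol times that of `u` is the image of `u` under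
the corresponding multiplier, on either side of the Fourier transform. -/
lemma multiplier_eq_of_fourier_eq {g : E3 → ℂ} (hg : g.HasTemperateGrowth) (he : ∀ ξ, g (-ξ) = g ξ)
    {u w : 𝓢(E3, ℂ)} (h : ∀ ξ, 𝓕 w ξ = g ξ * 𝓕 u ξ) :
    𝓕⁻ (SchwartzMap.smulLeftCLM ℂ g (𝓕 u)) = w ∧ 𝓕 (SchwartzMap.smulLeftCLM ℂ g (𝓕⁻ u)) = w := by
  constructor
  · have : SchwartzMap.smulLeftCLM ℂ g (𝓕 u) = 𝓕 w := by
      ext ξ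
      rw [SchwartzMap.smulLeftCLM_apply_apply hg, h, smul_eq_mul]
    rw [this, FourierTransform.fourierInv_fourier_eq]
  -- This order of the two transforms appears when the multiplier of a tempered distribution is
  -- transposed onto the test function. It agrees with the other order because `g` is even.
  · have : SchwartzMap.smulLeftCLM ℂ g (𝓕⁻ u) = 𝓕⁻ w := by
      ext ξ
      have hinv : ∀ f : 𝓢(E3, ℂ), 𝓕⁻ f ξ = 𝓕 f (-ξ) := fun f => by
        rw [SchwartzMap.fourierInv_coe, SchwartzMap.fourier_coe, Real.fourierInv_eq_fourier_neg]
      rw [SchwartzMap.smulLeftCLM_apply_apply hg, hinv, hinv, h, he, smul_eq_mul]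
    rw [this, FourierTransform.fourier_fourierInv_eq]

lemma sinMultiplier_radialTest (h : IsProfile α β ϕ) {b : ℝ} (hb : |b| < α) :
    SchwartzMap.fourierMultiplierCLM ℂ (sinSymbol b) (radialTest ϕ) =
      radialTest (halfWindow ϕ b) :=
  (multiplier_eq_of_fourier_eq (sinSymbol_hasTemperateGrowth b) (fun ξ => by simp [sinSymbol])
    (fourier_radialTest_sin h hb)).1

/-- d'Alembert's formula for the free wave propagator tested against a radial function. -/
lemma freeWave_radialTest (h : IsProfile α β ϕ) {b : ℝ} (hb : |b| < α) (f₀ f₁ : 𝓢'(E3, ℂ)) :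
    freeWave b f₀ f₁ (radialTest ϕ) = (1 / 2) * (f₀ (radialTest fun r => ϕ (r - b)) +
      f₀ (radialTest fun r => ϕ (r + b))) + f₁ (radialTest (halfWindow ϕ b)) := by
  have hs := (multiplier_eq_of_fourier_eq (sinSymbol_hasTemperateGrowth b)
    (fun ξ => by simp [sinSymbol]) (fourier_radialTest_sin h hb)).2
  have hc := (multiplier_eq_of_fourier_eq (cosSymbol_hasTemperateGrowth b)
    (fun ξ => by simp [cosSymbol]) (u := radialTest ϕ)
    (w := (1 / 2 : ℂ) • (radialTest (fun r => ϕ (r - b)) + radialTest fun r => ϕ (r + b)))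
    (fun ξ => by
      rw [FourierTransform.fourier_smul, FourierTransform.fourier_add, smul_apply, add_apply,
        fourier_radialTest_cos h hb ξ, cosSymbol, smul_eq_mul]
      ring)).2
  rw [freeWave, add_apply, TemperedDistribution.fourierMultiplierCLM_apply_apply,
    TemperedDistribution.fourierMultiplierCLM_apply_apply, hs, hc, map_smul, map_add, smul_eq_mul]

end Propagator

/-! ### Polar coordinates and radial pairings -/

section Polar

lemma integral_comp_norm (f : ℝ → ℝ) :
    ∫ x : E3, f ‖x‖ = 4 * Real.pi * ∫ r in Set.Ioi (0 : ℝ), r ^ 2 * f r := by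
  have h := integral_fun_norm_addHaar (volume : Measure E3) f
  have hv : (volume : Measure E3).real (Metric.ball 0 1) = 4 / 3 * Real.pi := by
    rw [Measure.real, EuclideanSpace.volume_ball_fin_three]
    simp
    rw [ENNReal.toReal_ofReal (by positivity)]
    ring
  rw [h, hv]
  simp
  ring

/-- The pairing of a function on `ℝ³` with the test function `ϕ(|x|)/|x|`. -/
def radialPair (V : E3 → ℝ) (ϕ : ℝ → ℝ) : ℝ := ∫ x, V x * (ϕ ‖x‖ / ‖x‖)

variable {α β : ℝ} {ϕ : ℝ → ℝ}

/-- The Jacobian `r²` absorbs the factor `1/r` of the function and that of the test function. -/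
lemma radialPair_eq (h : IsProfile α β ϕ) (hα : 0 < α) {V : E3 → ℝ} {v : ℝ → ℝ}
    (hV : ∀ x, α ≤ ‖x‖ → V x = v ‖x‖ / ‖x‖) :
    radialPair V ϕ = 4 * Real.pi * ∫ r, v r * ϕ r := by
  have h1 : radialPair V ϕ = ∫ x : E3, (fun r => v r / r * (ϕ r / r)) ‖x‖ := by
    refine integral_congr_ae (Eventually.of_forall fun x => ?_)
    by_cases hx : ‖x‖ ∈ Set.Icc α β
    · simp only [hV x hx.1]
    · simp only [h.eq_zero _ hx, zero_div, mul_zero]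
  refine h1.trans ((integral_comp_norm fun r => v r / r * (ϕ r / r)).trans ?_)
  congr 1
  rw [← integral_indicator measurableSet_Ioi]
  congr 1
  ext r
  by_cases hr : r ∈ Set.Ioi (0 : ℝ)
  · have : r ≠ 0 := ne_of_gt hr
    rw [Set.indicator_of_mem hr]
    field_simp
  · rw [Set.indicator_of_notMem hr, h.eq_zero r fun hr' => hr (hα.trans_le hr'.1), mul_zero]

end Polar

/-! ### Time-independent functions as solutions of a forced wave equation -/

section Stationary

variable {α β : ℝ} {ϕ v : ℝ → ℝ}

lemma IsProfile.integrable_mul (h : IsProfile α β ϕ) (hv : Continuous v) :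
    Integrable fun r => v r * ϕ r :=
  (hv.mul h.continuous).integrable_of_hasCompactSupport h.hasCompactSupport.mul_left

lemma hasDerivAt_integral_mul_comp_sub (hv : Continuous v) (h : IsProfile α β ϕ) (σ : ℝ) :
    HasDerivAt (fun σ => ∫ r, v r * ϕ (r - σ)) (-∫ r, v r * deriv ϕ (r - σ)) σ := by
  obtain ⟨M, hM0, hM⟩ := h.deriv.exists_bound
  have hi : ∀ {ψ : ℝ → ℝ}, IsProfile α β ψ → ∀ σ, Integrable fun r => v r * ψ (r - σ) :=
    fun hψ σ => (hψ.comp_sub σ).integrable_mul hv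
  rw [← integral_neg]
  refine (hasDerivAt_integral_of_dominated_loc_of_deriv_le
    (F := fun σ r => v r * ϕ (r - σ)) (F' := fun σ r => -(v r * deriv ϕ (r - σ)))
    (bound := (Set.Icc (α + σ - 1) (β + σ + 1)).indicator fun r => |v r| * M)
    (Metric.ball_mem_nhds σ one_pos) ?_ (hi h σ) (hi h.deriv σ).neg.aestronglyMeasurable ?_ ?_ ?_).2
  · exact Eventually.of_forall fun s => (hi h s).aestronglyMeasurable
  · refine Eventually.of_forall fun r s hs => ?_
    have hs' := abs_lt.1 (Metric.mem_ball.1 hs)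
    by_cases hr : r ∈ Set.Icc (α + σ - 1) (β + σ + 1)
    · rw [Set.indicator_of_mem hr, norm_neg, norm_mul]
      exact mul_le_mul_of_nonneg_left (hM _) (abs_nonneg _)
    · rw [Set.indicator_of_notMem hr, h.deriv.eq_zero, mul_zero, neg_zero, norm_zero]
      exact fun h' => hr ⟨by linarith [h'.1], by linarith [h'.2]⟩
  · rw [integrable_indicator_iff measurableSet_Icc]
    exact (hv.abs.mul continuous_const).integrableOn_Icc
  · refine Eventually.of_forall fun r s _ => ?_
    have h1 := ((h.hasDerivAt (r - s)).comp s ((hasDerivAt_id s).const_sub r)).const_mul (v r)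
    convert! h1 using 1
    ring

lemma integral_mul_deriv_profile {v' : ℝ → ℝ} (hv : ∀ r, HasDerivAt v (v' r) r) (hv' : Continuous v')
    (h : IsProfile α β ϕ) : ∫ r, v r * deriv ϕ r = -∫ r, v' r * ϕ r := by
  have hc : Continuous v := continuous_iff_continuousAt.2 fun r => (hv r).continuousAt
  exact integral_mul_deriv_eq_deriv_mul_of_integrable (fun r _ => hv r) (fun r _ => h.hasDerivAt r)
    (h.deriv.integrable_mul hc) (h.integrable_mul hv') (h.integrable_mul hc)

/-- The function `v`, as a stationary solution of `w_tt - w_rr = -v''`, satisfies d'Alembert's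
formula tested against a profile. -/
lemma stationary_profile (hv : ContDiff ℝ 2 v) (h : IsProfile α β ϕ) :
    (Continuous fun σ => ∫ r, deriv (deriv v) r * halfWindow ϕ σ r) ∧
    ∀ s, ∫ σ in (0 : ℝ)..s, ∫ r, deriv (deriv v) r * halfWindow ϕ σ r =
      1 / 2 * ((∫ r, v r * ϕ (r - s)) + ∫ r, v r * ϕ (r + s)) - ∫ r, v r * ϕ r := by
  have hv1 : ContDiff ℝ 1 (deriv v) := by
    have : ContDiff ℝ (1 + 1) v := by simpa [one_add_one_eq_two] using hv
    exact (contDiff_succ_iff_deriv.1 this).2.2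
  have hv2 : Continuous (deriv (deriv v)) := hv1.continuous_deriv (by simp)
  have hd : ∀ r, HasDerivAt v (deriv v r) r := fun r =>
    ((hv.differentiable (by simp)) r).hasDerivAt
  have hd1 : ∀ r, HasDerivAt (deriv v) (deriv (deriv v) r) r := fun r =>
    ((hv1.differentiable (by simp)) r).hasDerivAt
  -- This is the `σ`-derivative of the mean of the pairings of `v` with the two translates. Two
  -- integrations by parts identify it with the pairing of `v''` with the window average, so the
  -- claim is the fundamental theorem of calculus.
  set E' : ℝ → ℝ := fun σ =>
    1 / 2 * ((∫ r, v r * deriv ϕ (r + σ)) - ∫ r, v r * deriv ϕ (r - σ)) with hE'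
  have hshift : ∀ {ψ : ℝ → ℝ}, IsProfile α β ψ → ∀ σ,
      HasDerivAt (fun σ => ∫ r, v r * ψ (r + σ)) (∫ r, v r * deriv ψ (r + σ)) σ := fun hψ σ => by
    have h1 := (hasDerivAt_integral_mul_comp_sub hv.continuous hψ (-σ)).comp σ (hasDerivAt_neg σ)
    convert! h1 using 1
    · ext s; simp
    · simp
  have heq : ∀ σ, ∫ r, deriv (deriv v) r * halfWindow ϕ σ r = E' σ := by
    intro σ
    have hw := h.halfWindow σ
    have e1 := integral_mul_deriv_profile hd1 hv2 hw
    have hdw : deriv (halfWindow ϕ σ) = fun r => 1 / 2 * (ϕ (r + σ) - ϕ (r - σ)) :=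
      funext fun r => (hasDerivAt_halfWindow_right h.continuous σ r).deriv
    have hp : IsProfile (α + -σ) (β + -σ) fun r => ϕ (r + σ) := by simpa using h.comp_sub (-σ)
    have hm := h.comp_sub σ
    have e2 := integral_mul_deriv_profile hd hv1.continuous hp
    have e3 := integral_mul_deriv_profile hd hv1.continuous hm
    have hds : deriv (fun r => ϕ (r - σ)) = fun r => deriv ϕ (r - σ) :=
      funext fun r => deriv_comp_sub_const ..
    have hda : deriv (fun r => ϕ (r + σ)) = fun r => deriv ϕ (r + σ) :=
      funext fun r => deriv_comp_add_const ..
    rw [hda] at e2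
    rw [hds] at e3
    rw [hdw] at e1
    simp only [hE', e2, e3]
    have e4 : ∫ r, deriv v r * (1 / 2 * (ϕ (r + σ) - ϕ (r - σ))) =
        1 / 2 * ((∫ r, deriv v r * ϕ (r + σ)) - ∫ r, deriv v r * ϕ (r - σ)) := by
      rw [← integral_sub (hp.integrable_mul hv1.continuous) (hm.integrable_mul hv1.continuous),
        ← integral_const_mul]
      congr 1
      ext r
      ring
    rw [e4] at e1
    linarith
  have hcont : Continuous E' := by
    refine continuous_const.mul (Continuous.sub ?_ ?_)
    · exact continuous_iff_continuousAt.2 fun σ => (hshift h.deriv σ).continuousAt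
    · exact continuous_iff_continuousAt.2 fun σ =>
        (hasDerivAt_integral_mul_comp_sub hv.continuous h.deriv σ).continuousAt
  simp only [heq]
  refine ⟨hcont, fun s => ?_⟩
  rw [intervalIntegral.integral_eq_sub_of_hasDerivAt
    (f := fun σ => 1 / 2 * ((∫ r, v r * ϕ (r - σ)) + ∫ r, v r * ϕ (r + σ)))
    (fun σ _ => ?_) (hcont.intervalIntegrable _ _)]
  · simp only [sub_zero, add_zero]
    ring
  · convert! ((hasDerivAt_integral_mul_comp_sub hv.continuous h σ).add (hshift h σ)).const_mul
      (1 / 2) using 1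
    simp only [hE']
    ring

/-- A `C²` function on a half-line agrees on a smaller half-line with a `C²` function on `ℝ`. -/
lemma exists_contDiff_extension {v : ℝ → ℝ} {a b : ℝ} (hab : a < b)
    (hv : ContDiffOn ℝ 2 v (Set.Ioi a)) :
    ∃ w : ℝ → ℝ, ContDiff ℝ 2 w ∧ ∀ r, b ≤ r → w r = v r := by
  obtain ⟨c, hac, hcb⟩ := exists_between hab
  -- The cutoff vanishes up to `c`, which leaves room around points `r ≤ a`, and equals one from `b`
  -- on.
  refine ⟨fun r => Real.smoothTransition ((r - c) / (b - c)) * v r, ?_, fun r hr => ?_⟩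
  · refine contDiff_iff_contDiffAt.2 fun r => ?_
    rcases le_or_gt r a with hr | hr
    · refine (contDiffAt_const (c := (0 : ℝ))).congr_of_eventuallyEq ?_
      filter_upwards [Iio_mem_nhds (hr.trans_lt hac)] with s hs
      rw [Real.smoothTransition.zero_of_nonpos, zero_mul]
      exact div_nonpos_of_nonpos_of_nonneg (by linarith [Set.mem_Iio.1 hs]) (by linarith)
    · refine ContDiffAt.mul ?_ ((hv r hr).contDiffAt (Ioi_mem_nhds hr))
      exact Real.smoothTransition.contDiffAt.comp r
        ((contDiffAt_id.sub contDiffAt_const).div_const _)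
  · simp only
    rw [Real.smoothTransition.one_of_one_le, one_mul]
    rw [le_div_iff₀ (by linarith)]
    linarith

/-- `V` is the function `v(|x|)/|x|` and `L` its Laplacian `v''(|x|)/|x|` for `|x| > ρ`. -/
structure IsStationary (ρ : ℝ) (V L : E3 → ℝ) (v : ℝ → ℝ) : Prop where
  contDiff : ContDiff ℝ 2 v
  eq_div : ∀ x, ρ < ‖x‖ → V x = v ‖x‖ / ‖x‖
  laplacian_eq : ∀ x, ρ < ‖x‖ → L x = deriv (deriv v) ‖x‖ / ‖x‖

/-- The condition on `s`, which may have either sign, keeps every window average in the Duhamel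
integral supported where `V` and `L` are given by `v`; there `stationary_profile` applies. -/
lemma IsStationary.dalembert {ρ : ℝ} (hρ : 0 ≤ ρ) {V L : E3 → ℝ} (hV : IsStationary ρ V L v)
    (h : IsProfile α β ϕ) {t₀ s : ℝ} (hs : ρ < α - |s|) :
    IntervalIntegrable (fun τ => radialPair L (halfWindow ϕ (t₀ + s - τ))) volume t₀ (t₀ + s) ∧
    ∫ τ in t₀..(t₀ + s), radialPair L (halfWindow ϕ (t₀ + s - τ)) =
      1 / 2 * (radialPair V (fun r => ϕ (r - s)) + radialPair V (fun r => ϕ (r + s)))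
        - radialPair V ϕ := by
  have habs := abs_le.1 (le_refl |s|)
  have h0 := abs_nonneg s
  obtain ⟨hc, hi⟩ := stationary_profile hV.contDiff h
  have hp : IsProfile (α + -s) (β + -s) fun r => ϕ (r + s) := by simpa using h.comp_sub (-s)
  have e1 : radialPair V (fun r => ϕ (r - s)) = 4 * Real.pi * ∫ r, v r * ϕ (r - s) :=
    radialPair_eq (h.comp_sub s) (by linarith) fun x hx => hV.eq_div x (by linarith)
  have e2 : radialPair V (fun r => ϕ (r + s)) = 4 * Real.pi * ∫ r, v r * ϕ (r + s) :=
    radialPair_eq hp (by linarith) fun x hx => hV.eq_div x (by linarith)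
  have e3 : radialPair V ϕ = 4 * Real.pi * ∫ r, v r * ϕ r :=
    radialPair_eq h (by linarith) fun x hx => hV.eq_div x (by linarith)
  have hcongr : Set.EqOn (fun τ => radialPair L (halfWindow ϕ (t₀ + s - τ)))
      (fun τ => 4 * Real.pi * ∫ r, deriv (deriv v) r * halfWindow ϕ (t₀ + s - τ) r)
      (Set.uIcc t₀ (t₀ + s)) := by
    intro τ hτ
    have hτ' : |t₀ + s - τ| ≤ |s| := by
      rw [Set.mem_uIcc] at hτ
      rw [abs_le]
      constructor <;> rcases hτ with hτ | hτ <;> linarith [hτ.1, hτ.2]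
    exact radialPair_eq (h.halfWindow _) (by linarith) fun x hx => hV.laplacian_eq x (by linarith)
  have hcont : Continuous fun τ =>
      4 * Real.pi * ∫ r, deriv (deriv v) r * halfWindow ϕ (t₀ + s - τ) r :=
    continuous_const.mul (hc.comp (continuous_const.sub continuous_id))
  constructor
  · exact (hcont.intervalIntegrable _ _).congr fun τ hτ => (hcongr (Set.uIoc_subset_uIcc hτ)).symm
  · rw [intervalIntegral.integral_congr hcongr, intervalIntegral.integral_const_mul,
      intervalIntegral.integral_comp_sub_left
        (fun σ => ∫ r, deriv (deriv v) r * halfWindow ϕ σ r) (t₀ + s), e1, e2, e3]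
    simp only [sub_self, add_sub_cancel_left]
    rw [hi s]
    ring

end Stationary

/-! ### From radial pairings to almost everywhere bounds -/

section AEComparison

lemma ae_comp_norm {P : ℝ → Prop} (h : ∀ᵐ r : ℝ, P r) : ∀ᵐ x : E3, P ‖x‖ := by
  classical
  set N : ℝ → ℝ := Set.indicator {r | ¬ P r} 1 with hN
  have hz : ∀ᵐ r : ℝ, N r = 0 := by
    filter_upwards [h] with r hr
    rw [hN, Set.indicator_of_notMem]
    simpa using hr
  have hi : Integrable (fun x : E3 => N ‖x‖) := by
    rw [integrable_fun_norm_addHaar (volume : Measure E3)]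
    refine (integrable_zero _ _ _).congr (ae_restrict_of_ae ?_)
    filter_upwards [hz] with r hr
    simp [hr]
  have h0 : ∫ x : E3, N ‖x‖ = 0 := by
    rw [integral_comp_norm, integral_eq_zero_of_ae, mul_zero]
    refine ae_restrict_of_ae ?_
    filter_upwards [hz] with r hr
    simp [hr]
  have hnn : 0 ≤ fun x : E3 => N ‖x‖ := fun x =>
    Set.indicator_nonneg (fun _ _ => zero_le_one) _
  rw [integral_eq_zero_iff_of_nonneg hnn hi] at h0
  filter_upwards [h0] with x hx
  by_contra hP
  simp [hN, hP] at hx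

lemma IsProfile.integrable_mul_comp_norm {α β ρ : ℝ} {ϕ : ℝ → ℝ} (h : IsProfile α β ϕ) (hα : 0 < α)
    (hρ : ρ < α) {g : E3 → ℝ} (hloc : LocallyIntegrableOn g {x | ρ < ‖x‖}) :
    Integrable fun x => g x * ϕ ‖x‖ := by
  have hc := h.contDiff_comp_norm hα
  have hK : IsCompact (tsupport fun x : E3 => ϕ ‖x‖) := h.hasCompactSupport_comp_norm
  have hsub : tsupport (fun x : E3 => ϕ ‖x‖) ⊆ {x | ρ < ‖x‖} := fun x hx =>
    hρ.trans_le (h.tsupport_comp_norm_subset hx).1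
  have hi : IntegrableOn (fun x => g x * ϕ ‖x‖) (tsupport fun x : E3 => ϕ ‖x‖) :=
    (hloc.integrableOn_compact_subset hsub hK).mul_continuousOn hc.continuous.continuousOn hK
  rw [integrableOn_iff_integrable_of_support_subset] at hi
  · exact hi
  · exact (Function.support_mul_subset_right _ _).trans (subset_tsupport _)

lemma IsProfile.integrable_mul_radialTest {α β ρ : ℝ} {ϕ : ℝ → ℝ} (h : IsProfile α β ϕ) (hα : 0 < α)
    (hρ : ρ < α) {g : E3 → ℝ} (hloc : LocallyIntegrableOn g {x | ρ < ‖x‖}) :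
    Integrable fun x => g x * (ϕ ‖x‖ / ‖x‖) := by
  have h1 := h.div_pow hα 1
  simp only [pow_one] at h1
  exact h1.integrable_mul_comp_norm hα hρ hloc

/-- A radial function whose pairings with nonnegative radial test functions are nonpositive is
nonpositive. -/
lemma ae_nonpos_of_radialPair_nonpos {ρ : ℝ} (hρ : 0 ≤ ρ) {g : E3 → ℝ} {gr : ℝ → ℝ}
    (hg : ∀ x, ρ < ‖x‖ → g x = gr ‖x‖) (hloc : LocallyIntegrableOn g {x | ρ < ‖x‖})
    (h : ∀ α β ϕ, IsProfile α β ϕ → ρ < α → (∀ r, 0 ≤ ϕ r) → radialPair g ϕ ≤ 0) :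
    ∀ᵐ x, ρ < ‖x‖ → g x ≤ 0 := by
  have key : ∀ a b : ℝ, ρ < a → ∀ᵐ r : ℝ, r ∈ Set.Ioo a b → gr r ≤ 0 := by
    intro a b ha
    -- With the Jacobian included, local integrability on `ℝ³` becomes integrability on the line, as
    -- Lebesgue differentiation requires; the sign is that of `gr` for `r > 0`.
    set k : ℝ → ℝ := fun r => r ^ 2 * (Set.Icc a b).indicator gr r with hk
    have hint : Integrable k := by
      have h1 : Integrable fun x : E3 => (Set.Icc a b).indicator gr ‖x‖ := by
        have hK : IsCompact {x : E3 | a ≤ ‖x‖ ∧ ‖x‖ ≤ b} := by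
          refine (isCompact_closedBall (0 : E3) b).of_isClosed_subset
            ((isClosed_le continuous_const continuous_norm).inter
            (isClosed_le continuous_norm continuous_const)) fun x hx => by simpa using hx.2
        have h2 := hloc.integrableOn_compact_subset (fun x hx => ha.trans_le hx.1) hK
        rw [← integrable_indicator_iff hK.measurableSet] at h2
        refine h2.congr (Eventually.of_forall fun x => ?_)
        beta_reduce
        by_cases hx : a ≤ ‖x‖ ∧ ‖x‖ ≤ b
        · rw [Set.indicator_of_mem (show x ∈ {x : E3 | a ≤ ‖x‖ ∧ ‖x‖ ≤ b} from hx),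
            Set.indicator_of_mem (show ‖x‖ ∈ Set.Icc a b from hx), hg x (ha.trans_le hx.1)]
        · rw [Set.indicator_of_notMem (show x ∉ {x : E3 | a ≤ ‖x‖ ∧ ‖x‖ ≤ b} from hx),
            Set.indicator_of_notMem (show ‖x‖ ∉ Set.Icc a b from hx)]
      rw [integrable_fun_norm_addHaar (volume : Measure E3)] at h1
      rw [integrableOn_iff_integrable_of_support_subset] at h1
      · simpa [hk] using h1
      · intro r hr
        by_contra hr'
        refine hr ?_
        simp only
        rw [Set.indicator_of_notMem fun h => hr' (hρ.trans_lt (ha.trans_le h.1)), smul_zero]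
    let φ : ℕ → ContDiffBump (0 : ℝ) := fun n =>
      { rIn := 1 / ((n : ℝ) + 1), rOut := 2 * (1 / ((n : ℝ) + 1)),
        rIn_pos := by positivity, rIn_lt_rOut := by
          have : 0 < 1 / ((n : ℝ) + 1) := by positivity
          linarith }
    have hφ : Tendsto (fun n => (φ n).rOut) atTop (𝓝 0) := by
      have := (tendsto_one_div_add_atTop_nhds_zero_nat (𝕜 := ℝ)).const_mul 2
      rw [mul_zero] at this
      exact this
    have hae := ContDiffBump.ae_convolution_tendsto_right_of_locallyIntegrable (μ := volume)
      (φ := φ) (K := 2) hφ (Eventually.of_forall fun n => le_rfl) hint.locallyIntegrable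
    filter_upwards [hae] with r hr hrab
    have hlim : k r ≤ 0 := by
      refine le_of_tendsto hr ?_
      have hδ : ∀ᶠ n in atTop, (φ n).rOut < min (r - a) (b - r) :=
        hφ.eventually_lt_const (lt_min (by linarith [hrab.1]) (by linarith [hrab.2]))
      filter_upwards [hδ] with n hn
      set η : ℝ → ℝ := fun s => (φ n).normed volume (r - s) with hη
      have hηp : IsProfile a b η := by
        refine ⟨(φ n).contDiff_normed.comp (contDiff_const.sub contDiff_id), fun s hs => ?_⟩
        by_contra h0
        have h1 : r - s ∈ Function.support ((φ n).normed volume) := h0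
        rw [ContDiffBump.support_normed_eq, mem_ball_zero_iff, Real.norm_eq_abs, abs_lt] at h1
        have h2 := lt_min_iff.1 hn
        exact hs ⟨by linarith [h1.2, h2.1], by linarith [h1.1, h2.2]⟩
      -- The profile `s η(s)` makes the pairing equal to `4π` times the mollification of `k` at `r`.
      have hpair := h a b _ hηp.id_mul ha fun s => by
        by_cases hs : s ∈ Set.Icc a b
        · exact mul_nonneg (by linarith [hs.1]) ((φ n).nonneg_normed _)
        · rw [hηp.eq_zero s hs, mul_zero]
      rw [radialPair_eq (v := fun r => r * gr r) hηp.id_mul (hρ.trans_lt ha) fun x hx => by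
        have hx0 : ‖x‖ ≠ 0 := by linarith
        rw [hg x (ha.trans_le hx)]
        field_simp] at hpair
      have hconv : convolution ((φ n).normed volume) k (ContinuousLinearMap.lsmul ℝ ℝ) volume r =
          ∫ s, s * gr s * (s * η s) := by
        rw [convolution_eq_swap]
        refine integral_congr_ae (Eventually.of_forall fun s => ?_)
        simp only [ContinuousLinearMap.lsmul_apply, smul_eq_mul, hk]
        by_cases hs : s ∈ Set.Icc a b
        · rw [Set.indicator_of_mem hs]
          simp only [hη]
          ring
        · rw [Set.indicator_of_notMem hs, hηp.eq_zero s hs]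
          ring
      rw [hconv]
      by_contra hpos
      push Not at hpos
      have := mul_pos (by positivity : 0 < 4 * Real.pi) hpos
      linarith
    simp only [hk] at hlim
    rw [Set.indicator_of_mem (Set.Ioo_subset_Icc_self hrab)] at hlim
    have hr0 : 0 < r ^ 2 := pow_pos (by linarith [hrab.1]) 2
    by_contra hpos
    push Not at hpos
    linarith [mul_pos hr0 hpos]
  have h1 : ∀ᵐ r : ℝ, ∀ n : ℕ, r ∈ Set.Ioo (ρ + 1 / ((n : ℝ) + 1)) n → gr r ≤ 0 :=
    ae_all_iff.2 fun n => key _ _ (by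
      have : 0 < 1 / ((n : ℝ) + 1) := by positivity
      linarith)
  filter_upwards [ae_comp_norm h1] with x hx hxρ
  rw [hg x hxρ]
  obtain ⟨n, hn⟩ := exists_nat_one_div_lt (sub_pos.2 hxρ)
  obtain ⟨m, hm⟩ := exists_nat_gt ‖x‖
  refine hx (max n m) ⟨?_, hm.trans_le (by exact_mod_cast le_max_right n m)⟩
  have : 1 / (((max n m : ℕ) : ℝ) + 1) ≤ 1 / ((n : ℝ) + 1) := by
    apply one_div_le_one_div_of_le (by positivity)
    have : (n : ℝ) ≤ (max n m : ℕ) := by exact_mod_cast le_max_left n m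
    linarith
  linarith

/-- A radial function is bounded by `B` if its pairings with nonnegative radial test functions
are. -/
lemma ae_abs_le_of_abs_radialPair_le {ρ : ℝ} (hρ : 0 ≤ ρ) {f B : E3 → ℝ} {fr Br : ℝ → ℝ}
    (hf : ∀ x, ρ < ‖x‖ → f x = fr ‖x‖) (hB : ∀ x, ρ < ‖x‖ → B x = Br ‖x‖)
    (hfl : LocallyIntegrableOn f {x | ρ < ‖x‖}) (hBl : LocallyIntegrableOn B {x | ρ < ‖x‖})
    (h : ∀ α β ϕ, IsProfile α β ϕ → ρ < α → (∀ r, 0 ≤ ϕ r) →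
      |radialPair f ϕ| ≤ radialPair B ϕ) :
    ∀ᵐ x, ρ < ‖x‖ → |f x| ≤ B x := by
  have h1 := ae_nonpos_of_radialPair_nonpos hρ (g := fun x => f x - B x)
    (gr := fun r => fr r - Br r) (fun x hx => by rw [hf x hx, hB x hx]) (hfl.sub hBl)
    fun α β ϕ hϕ hα hn => by
      have h2 : radialPair (fun x => f x - B x) ϕ = radialPair f ϕ - radialPair B ϕ := by
        simp only [radialPair, sub_mul]
        exact integral_sub (hϕ.integrable_mul_radialTest (hρ.trans_lt hα) hα hfl)
          (hϕ.integrable_mul_radialTest (hρ.trans_lt hα) hα hBl)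
      linarith [(abs_le.1 (h α β ϕ hϕ hα hn)).2]
  have h2 := ae_nonpos_of_radialPair_nonpos hρ (g := fun x => -f x - B x)
    (gr := fun r => -fr r - Br r) (fun x hx => by rw [hf x hx, hB x hx]) (hfl.neg.sub hBl)
    fun α β ϕ hϕ hα hn => by
      have h2 : radialPair (fun x => -f x - B x) ϕ = -radialPair f ϕ - radialPair B ϕ := by
        simp only [radialPair, sub_mul, neg_mul]
        rw [← integral_neg]
        exact integral_sub (hϕ.integrable_mul_radialTest (hρ.trans_lt hα) hα hfl).neg
          (hϕ.integrable_mul_radialTest (hρ.trans_lt hα) hα hBl)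
      linarith [(abs_le.1 (h α β ϕ hϕ hα hn)).1]
  filter_upwards [h1, h2] with x h1 h2 hx
  exact abs_le.2 ⟨by linarith [h2 hx], by linarith [h1 hx]⟩

end AEComparison

/-! ### Weak gradients against radial vector fields -/

section Divergence

lemma LocallyIntegrableOn.integrable_smul_of_tsupport {E : Type*} [NormedAddCommGroup E]
    [NormedSpace ℝ E] {g : E3 → E} {U : Set E3} (hg : LocallyIntegrableOn g U) {φ : E3 → ℝ}
    (hφ : Continuous φ) (hc : HasCompactSupport φ) (hs : tsupport φ ⊆ U) :
    Integrable fun x => φ x • g x := by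
  have hK : IsCompact (tsupport φ) := hc
  have hi : IntegrableOn (fun x => φ x • g x) (tsupport φ) :=
    (hg.integrableOn_compact_subset hs hK).continuousOn_smul hφ.continuousOn hK
  rw [integrableOn_iff_integrable_of_support_subset] at hi
  · exact hi
  · exact (Function.support_smul_subset_left _ _).trans (subset_tsupport _)

variable {α β : ℝ} {ψ : ℝ → ℝ}

/-- The weak gradient tested against the radial vector field `x ψ(|x|)/|x|³`, whose divergence is
`ψ'(|x|)/|x|²`. -/
lemma IsWeakGradientOn.radial_pairing {f : E3 → ℝ} {g : E3 → E3} (h : IsWeakGradientOn f g {0}ᶜ)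
    (hψ : IsProfile α β ψ) (hα : 0 < α) :
    ∫ x, f x * (deriv ψ ‖x‖ / ‖x‖ ^ 2) = -∫ x, inner ℝ (g x) x * (ψ ‖x‖ / ‖x‖ ^ 3) := by
  obtain ⟨hf, hg, hw⟩ := h
  have hκ := hψ.div_pow hα 3
  set κ : ℝ → ℝ := fun r => ψ r / r ^ 3 with hκdef
  set e : Fin 3 → E3 := fun i => EuclideanSpace.single i (1 : ℝ) with he
  set φ : Fin 3 → E3 → ℝ := fun i x => κ ‖x‖ * inner ℝ (e i) x with hφdef
  have hφ : ∀ i, ContDiff ℝ (⊤ : ℕ∞) (φ i) := fun i =>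
    (hκ.contDiff_comp_norm hα).mul (contDiff_const.inner ℝ contDiff_id)
  have hφc : ∀ i, HasCompactSupport (φ i) := fun i => hκ.hasCompactSupport_comp_norm.mul_right
  have hφs : ∀ i, tsupport (φ i) ⊆ {0}ᶜ := fun i x hx => by
    have h1 := hκ.tsupport_comp_norm_subset (tsupport_mul_subset_left hx)
    rintro rfl
    have := h1.1
    rw [norm_zero] at this
    linarith
  have hd : ∀ x : E3, x ≠ 0 → ∀ i, fderiv ℝ (φ i) x (e i) =
      κ ‖x‖ + (deriv ψ ‖x‖ / ‖x‖ ^ 3 - 3 * ψ ‖x‖ / ‖x‖ ^ 4) / ‖x‖ * (x i) ^ 2 := by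
    intro x hx i
    have h0 : ‖x‖ ≠ 0 := by simpa using hx
    have h1 : HasDerivAt κ (deriv ψ ‖x‖ / ‖x‖ ^ 3 - 3 * ψ ‖x‖ / ‖x‖ ^ 4) ‖x‖ := by
      convert! (hψ.hasDerivAt ‖x‖).div ((hasDerivAt_id _).pow 3) (pow_ne_zero 3 h0) using 1
      simp
      field_simp
    have h2 := (hasFDerivAt_comp_norm_of_ne hx h1).mul ((innerSL ℝ (e i)).hasFDerivAt (x := x))
    have h3 : fderiv ℝ (φ i) x = _ := h2.fderiv
    have hin : ∀ y z : E3, innerSL ℝ y z = inner ℝ y z := fun _ _ => rfl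
    have hxi : inner ℝ x (e i) = x i := by simp [he, EuclideanSpace.inner_single_right]
    have hxi' : inner ℝ (e i) x = x i := by rw [real_inner_comm, hxi]
    have hii : inner ℝ (e i) (e i) = (1 : ℝ) := by simp [he]
    rw [h3]
    simp only [add_apply, smul_apply, hin, hxi, hxi', hii, smul_eq_mul]
    ring
  have hint1 : ∀ i, Integrable fun x => f x * fderiv ℝ (φ i) x (e i) := fun i => by
    have hc : Continuous fun x => fderiv ℝ (φ i) x (e i) :=
      ((hφ i).continuous_fderiv (by simp)).clm_apply continuous_const
    have hcs : HasCompactSupport fun x => fderiv ℝ (φ i) x (e i) :=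
      (hφc i).fderiv_apply (𝕜 := ℝ) (e i)
    have hsub : tsupport (fun x => fderiv ℝ (φ i) x (e i)) ⊆ {0}ᶜ :=
      (tsupport_fderiv_apply_subset ℝ (e i)).trans (hφs i)
    have := LocallyIntegrableOn.integrable_smul_of_tsupport hf hc hcs hsub
    simpa [mul_comm] using this
  have hint2 : ∀ i, Integrable fun x => inner ℝ (g x) (e i) * φ i x := fun i => by
    have := (LocallyIntegrableOn.integrable_smul_of_tsupport hg (hφ i).continuous (hφc i)
      (hφs i)).inner_const (𝕜 := ℝ) (e i)
    refine this.congr (Eventually.of_forall fun x => ?_)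
    simp only [real_inner_smul_left]
    ring
  have hsum : ∑ i, ∫ x, f x * fderiv ℝ (φ i) x (e i) = ∑ i, -∫ x, inner ℝ (g x) (e i) * φ i x :=
    Finset.sum_congr rfl fun i _ => hw (φ i) (hφ i) (hφc i) (hφs i) (e i)
  rw [Finset.sum_neg_distrib, ← integral_finsetSum _ fun i _ => hint1 i,
    ← integral_finsetSum _ fun i _ => hint2 i] at hsum
  have hL : ∫ x, ∑ i, f x * fderiv ℝ (φ i) x (e i) = ∫ x, f x * (deriv ψ ‖x‖ / ‖x‖ ^ 2) := by
    refine integral_congr_ae ?_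
    filter_upwards [Measure.ae_ne volume (0 : E3)] with x hx
    have h0 : ‖x‖ ≠ 0 := by simpa using hx
    have hsq : x 0 ^ 2 + x 1 ^ 2 + x 2 ^ 2 = ‖x‖ ^ 2 := by
      rw [EuclideanSpace.norm_sq_eq, Fin.sum_univ_three]
      simp
    simp only [hd x hx, Fin.sum_univ_three]
    rw [← mul_add, ← mul_add]
    congr 1
    trans 3 * κ ‖x‖ + (deriv ψ ‖x‖ / ‖x‖ ^ 3 - 3 * ψ ‖x‖ / ‖x‖ ^ 4) / ‖x‖ *
      (x 0 ^ 2 + x 1 ^ 2 + x 2 ^ 2)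
    · ring
    · rw [hsq]
      simp only [hκdef]
      field_simp
      ring
  have hR : ∫ x, ∑ i, inner ℝ (g x) (e i) * φ i x = ∫ x, inner ℝ (g x) x * (ψ ‖x‖ / ‖x‖ ^ 3) := by
    refine integral_congr_ae (Eventually.of_forall fun x => ?_)
    have hb := (EuclideanSpace.basisFun (Fin 3) ℝ).sum_inner_mul_inner (g x) x
    simp only [EuclideanSpace.basisFun_apply] at hb
    simp only [hφdef, hκdef]
    rw [← hb, Finset.sum_mul]
    exact Finset.sum_congr rfl fun i _ => by simp only [he]; ring
  rw [← hL, hsum, hR]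

end Divergence

/-! ### Energy bounds on exterior domains -/

section Energy

lemma lintegral_one_div_norm_pow_four {r₀ : ℝ} (hr : 0 < r₀) :
    IntegrableOn (fun x : E3 => 1 / ‖x‖ ^ 4) {x | r₀ < ‖x‖} ∧
      ∫ x in {x : E3 | r₀ < ‖x‖}, 1 / ‖x‖ ^ 4 = 4 * Real.pi / r₀ := by
  have hm : MeasurableSet {x : E3 | r₀ < ‖x‖} :=
    (isOpen_lt continuous_const continuous_norm).measurableSet
  have hind : ({x : E3 | r₀ < ‖x‖}.indicator fun x : E3 => 1 / ‖x‖ ^ 4) =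
      fun x : E3 => (Set.Ioi r₀).indicator (fun r => 1 / r ^ 4) ‖x‖ := rfl
  have hEq : ∀ r ∈ Set.Ioi (0 : ℝ), r ^ 2 * (Set.Ioi r₀).indicator (fun r => 1 / r ^ 4) r =
      (Set.Ioi r₀).indicator (fun r => r ^ (-2 : ℝ)) r := by
    intro r hr0
    by_cases hr : r ∈ Set.Ioi r₀
    · rw [Set.indicator_of_mem hr, Set.indicator_of_mem hr, Real.rpow_neg (le_of_lt hr0)]
      have : r ≠ 0 := ne_of_gt hr0
      norm_cast
      field_simp
    · rw [Set.indicator_of_notMem hr, Set.indicator_of_notMem hr, mul_zero]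
  constructor
  · rw [← integrable_indicator_iff hm, hind, integrable_fun_norm_addHaar (volume : Measure E3)]
    have : IntegrableOn ((Set.Ioi r₀).indicator (fun r : ℝ => r ^ (-2 : ℝ))) (Set.Ioi 0) :=
      ((integrable_indicator_iff measurableSet_Ioi).2
        (integrableOn_Ioi_rpow_of_lt (by norm_num) hr)).integrableOn
    refine this.congr_fun (fun r hr0 => ?_) measurableSet_Ioi
    simpa using (hEq r hr0).symm
  · rw [← integral_indicator hm, hind, integral_comp_norm,
      setIntegral_congr_fun measurableSet_Ioi hEq, setIntegral_indicator measurableSet_Ioi,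
      Set.inter_eq_right.2 (Set.Ioi_subset_Ioi hr.le), integral_Ioi_rpow_of_lt (by norm_num) hr]
    norm_num
    rw [Real.rpow_neg_one]
    ring

/-- Summing an energy bound over dyadic annuli. -/
lemma lintegral_exterior_le {C : ℝ} {G : E3 → ℝ≥0∞}
    (h : ∀ r : ℝ, 0 < r → ∫⁻ x in {x : E3 | r < ‖x‖ ∧ ‖x‖ < 4 * r}, G x ≤ ENNReal.ofReal (C * r⁻¹))
    {r₀ : ℝ} (hr : 0 < r₀) :
    ∫⁻ x in {x : E3 | r₀ < ‖x‖}, G x ≤ ENNReal.ofReal (2 * |C| / r₀) := by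
  set A : ℕ → Set E3 := fun k => {x | 2 ^ k * r₀ < ‖x‖ ∧ ‖x‖ < 4 * (2 ^ k * r₀)} with hA
  have hsub : {x : E3 | r₀ < ‖x‖} ⊆ ⋃ k, A k := by
    intro x hx
    have hx' : r₀ < ‖x‖ := hx
    obtain ⟨n, hn⟩ := exists_nat_pow_near (x := ‖x‖ / r₀) (y := 2)
      (by rw [le_div_iff₀ hr]; linarith) (by norm_num)
    rw [le_div_iff₀ hr, div_lt_iff₀ hr] at hn
    rcases hn.1.lt_or_eq with h1 | h1
    · refine Set.mem_iUnion.2 ⟨n, h1, hn.2.trans ?_⟩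
      rw [pow_succ]
      have : 0 < 2 ^ n * r₀ := by positivity
      linarith
    -- A point with `‖x‖ = 2^n r₀` is not in the open annulus `A n`, but it lies inside the
    -- preceding one because the outer radius is four times the inner.
    · rcases n with _ | n
      · simp at h1; linarith
      · refine Set.mem_iUnion.2 ⟨n, ?_, ?_⟩ <;> rw [← h1, pow_succ] <;>
        have : 0 < 2 ^ n * r₀ := by positivity
        · linarith
        · linarith
  calc _ ≤ ∫⁻ x in ⋃ k, A k, G x := lintegral_mono_set hsub
    _ ≤ ∑' k, ∫⁻ x in A k, G x := lintegral_iUnion_le _ _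
    _ ≤ ∑' k : ℕ, ENNReal.ofReal (|C| / r₀ * (1 / 2) ^ k) := by
      refine ENNReal.tsum_le_tsum fun k => (h (2 ^ k * r₀) (by positivity)).trans ?_
      apply ENNReal.ofReal_le_ofReal
      calc C * (2 ^ k * r₀)⁻¹ ≤ |C| * (2 ^ k * r₀)⁻¹ := by
            gcongr
            exact le_abs_self C
        _ = _ := by
            rw [div_pow, one_pow]
            field_simp
    _ = ENNReal.ofReal (∑' k : ℕ, |C| / r₀ * (1 / 2) ^ k) :=
      (ENNReal.ofReal_tsum_of_nonneg (fun k => by positivity)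
        (summable_geometric_two.mul_left _)).symm
    _ = _ := by
      rw [tsum_mul_left, tsum_geometric_two]
      ring_nf

/-- By `2ab ≤ a² + b²` the integrand splits into `‖g‖²` and `‖x‖⁻⁴`, whose exterior integrals both
scale as `1/r₀`. -/
lemma integral_gradient_weighted_le {C : ℝ} {g : E3 → E3} (hg : LocallyIntegrableOn g {0}ᶜ)
    (h : ∀ r : ℝ, 0 < r →
      ∫⁻ x in {x : E3 | r < ‖x‖ ∧ ‖x‖ < 4 * r}, ‖g x‖ₑ ^ 2 ≤ ENNReal.ofReal (C * r⁻¹))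
    {r₀ : ℝ} (hr : 0 < r₀) :
    IntegrableOn (fun x => ‖g x‖ / ‖x‖ ^ 2) {x | r₀ < ‖x‖} ∧
      ∫ x in {x : E3 | r₀ < ‖x‖}, ‖g x‖ / ‖x‖ ^ 2 ≤ (|C| + 2 * Real.pi) / r₀ := by
  have hm : MeasurableSet {x : E3 | r₀ < ‖x‖} :=
    (isOpen_lt continuous_const continuous_norm).measurableSet
  have hsub : {x : E3 | r₀ < ‖x‖} ⊆ {0}ᶜ := fun x hx => by
    rintro rfl
    have : r₀ < ‖(0 : E3)‖ := hx
    rw [norm_zero] at this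
    linarith
  have hgm : AEStronglyMeasurable g (volume.restrict {x : E3 | r₀ < ‖x‖}) :=
    hg.aestronglyMeasurable.mono_measure (Measure.restrict_mono hsub le_rfl)
  have hl := lintegral_exterior_le h hr
  have hle : ∫⁻ x in {x : E3 | r₀ < ‖x‖}, ENNReal.ofReal (‖g x‖ ^ 2) ≤
      ENNReal.ofReal (2 * |C| / r₀) := by
    refine le_trans (le_of_eq (lintegral_congr fun x => ?_)) hl
    rw [ENNReal.ofReal_pow (norm_nonneg _), ofReal_norm]
  have hnn : 0 ≤ᵐ[volume.restrict {x : E3 | r₀ < ‖x‖}] fun x => ‖g x‖ ^ 2 :=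
    Eventually.of_forall fun x => by positivity
  have hi1 : IntegrableOn (fun x => ‖g x‖ ^ 2) {x : E3 | r₀ < ‖x‖} := by
    refine ⟨hgm.norm.pow 2, ?_⟩
    rw [hasFiniteIntegral_iff_ofReal hnn]
    exact hle.trans_lt ENNReal.ofReal_lt_top
  have hb1 : ∫ x in {x : E3 | r₀ < ‖x‖}, ‖g x‖ ^ 2 ≤ 2 * |C| / r₀ := by
    rw [integral_eq_lintegral_of_nonneg_ae hnn (hgm.norm.pow 2)]
    exact ENNReal.toReal_le_of_le_ofReal (by positivity) hle
  obtain ⟨hi2, hb2⟩ := lintegral_one_div_norm_pow_four hr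
  have hpt : ∀ x : E3, ‖g x‖ / ‖x‖ ^ 2 ≤ 1 / 2 * (‖g x‖ ^ 2 + 1 / ‖x‖ ^ 4) := fun x => by
    have := sq_nonneg (‖g x‖ - 1 / ‖x‖ ^ 2)
    have e : (1 / ‖x‖ ^ 2) ^ 2 = 1 / ‖x‖ ^ 4 := by rw [div_pow, one_pow, ← pow_mul]
    rw [div_eq_mul_one_div]
    nlinarith
  have hi3 : IntegrableOn (fun x => 1 / 2 * (‖g x‖ ^ 2 + 1 / ‖x‖ ^ 4)) {x : E3 | r₀ < ‖x‖} :=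
    (hi1.add hi2).const_mul _
  have hi : IntegrableOn (fun x => ‖g x‖ / ‖x‖ ^ 2) {x : E3 | r₀ < ‖x‖} := by
    refine Integrable.mono' hi3 ?_ (Eventually.of_forall fun x => ?_)
    · have hmeas : Measurable fun x : E3 => (‖x‖ ^ 2)⁻¹ := (measurable_norm.pow_const 2).inv
      exact hgm.norm.mul hmeas.aestronglyMeasurable
    · rw [Real.norm_of_nonneg (by positivity)]
      exact hpt x
  refine ⟨hi, (setIntegral_mono hi hi3 hpt).trans ?_⟩
  rw [integral_const_mul, integral_add hi1 hi2, hb2]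
  calc _ ≤ 1 / 2 * (2 * |C| / r₀ + 4 * Real.pi / r₀) := by gcongr
    _ = _ := by ring

end Energy

/-! ### Pointwise `1/|x|` decay from the energy bound -/

section Decay

/-- Zero mean is what makes the primitive vanish again to the right of the support. -/
lemma IsProfile.antideriv {α β : ℝ} {χ : ℝ → ℝ} (h : IsProfile α β χ) (hα : 0 < α)
    (h0 : ∫ r, χ r = 0) :
    IsProfile α β (fun r => ∫ s in (0 : ℝ)..r, χ s) ∧
      _root_.deriv (fun r => ∫ s in (0 : ℝ)..r, χ s) = χ := by
  have hd : _root_.deriv (fun r => ∫ s in (0 : ℝ)..r, χ s) = χ :=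
    funext fun r => (hasDerivAt_integral_of_continuous h.continuous r).deriv
  refine ⟨⟨?_, fun r hr => ?_⟩, hd⟩
  · rw [contDiff_infty_iff_deriv, hd]
    exact ⟨fun r => (hasDerivAt_integral_of_continuous h.continuous r).differentiableAt, h.smooth⟩
  · rcases lt_or_ge r α with hr1 | hr1
    · rw [intervalIntegral.integral_congr (g := fun _ => 0), intervalIntegral.integral_zero]
      intro s hs
      refine h.eq_zero s fun hs' => ?_
      rw [Set.mem_uIcc] at hs
      rcases hs with hs | hs <;> linarith [hs.1, hs.2, hs'.1]
    · have hr2 : β < r := by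
        by_contra hcon
        exact hr ⟨hr1, not_lt.1 hcon⟩
      rw [intervalIntegral.integral_eq_integral_of_support_subset, h0]
      intro s hs
      by_contra hs'
      refine hs (h.eq_zero s fun h' => hs' ⟨by linarith [h'.1], by linarith [h'.2]⟩)

lemma IsProfile.integrable {α β : ℝ} {χ : ℝ → ℝ} (h : IsProfile α β χ) : Integrable χ :=
  h.continuous.integrable_of_hasCompactSupport h.hasCompactSupport

lemma intervalIntegral_mem_Icc {χ : ℝ → ℝ} (hi : Integrable χ) (hn : ∀ r, 0 ≤ χ r) {r : ℝ}
    (hr : 0 ≤ r) : (∫ s in (0 : ℝ)..r, χ s) ∈ Set.Icc 0 (∫ s, χ s) := by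
  refine ⟨intervalIntegral.integral_nonneg hr fun s _ => hn s, ?_⟩
  rw [intervalIntegral.integral_of_le hr]
  exact setIntegral_le_integral hi (Eventually.of_forall hn)

/-- A nonnegative profile of integral one supported in `[N, 3N]`. -/
lemma exists_unit_profile {N : ℝ} (hN : 0 < N) :
    ∃ η : ℝ → ℝ, IsProfile N (3 * N) η ∧ (∀ r, 0 ≤ η r) ∧ ∫ r, η r = 1 := by
  let b : ContDiffBump (2 * N : ℝ) := ⟨N / 2, N, by linarith, by linarith⟩
  refine ⟨b.normed volume, ⟨b.contDiff_normed, fun r hr => ?_⟩, b.nonneg_normed, b.integral_normed⟩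
  by_contra h0
  have h1 : r ∈ Function.support (b.normed volume) := h0
  rw [ContDiffBump.support_normed_eq, Metric.mem_ball, Real.dist_eq, abs_lt] at h1
  exact hr ⟨by linarith [h1.1], by linarith [h1.2]⟩

lemma radialPair_const {α β : ℝ} {ϕ : ℝ → ℝ} (h : IsProfile α β ϕ) (hα : 0 < α) (c : ℝ) :
    radialPair (fun _ => c) ϕ = 4 * Real.pi * (c * ∫ r, r * ϕ r) := by
  rw [radialPair_eq (v := fun r => c * r) h hα fun x hx => by
    have : ‖x‖ ≠ 0 := by linarith
    field_simp]
  simp only [mul_assoc]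
  rw [integral_const_mul]

variable {C : ℝ} {f : E3 → ℝ} {g : E3 → E3}

/-- A weak form of integrating the radial derivative from infinity. With `m = ∫ r ϕ`, subtract from
`r ϕ` the mass `m` placed at radius about `N`; the difference has zero mean, hence is `ψ'` with `|ψ|
≤ m`, and the divergence theorem moves the derivative onto `f`. The displaced mass contributes
`O(1/N)`, so the far-field constant `C'` drops out of the final bound. -/
lemma abs_radialPair_le_of_energy (hwg : IsWeakGradientOn f g {0}ᶜ)
    (hE : ∀ r : ℝ, 0 < r →
      ∫⁻ x in {x : E3 | r < ‖x‖ ∧ ‖x‖ < 4 * r}, ‖g x‖ₑ ^ 2 ≤ ENNReal.ofReal (C * r⁻¹))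
    (hfar : ∃ C' ρ : ℝ, ∀ᵐ x, ρ < ‖x‖ → |f x| ≤ C' / ‖x‖)
    {r₀ α β : ℝ} (hr : 0 < r₀) {ϕ : ℝ → ℝ} (h : IsProfile α β ϕ) (hα : r₀ < α)
    (hn : ∀ r, 0 ≤ ϕ r) :
    |radialPair f ϕ| ≤ (|C| + 2 * Real.pi) / r₀ * ∫ r, r * ϕ r := by
  obtain ⟨C', ρ, hfar⟩ := hfar
  have hα0 : 0 < α := hr.trans hα
  set m := ∫ r, r * ϕ r with hm
  have hrn : ∀ r, 0 ≤ r * ϕ r := fun r => by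
    by_cases hr' : r ∈ Set.Icc α β
    · exact mul_nonneg (hα0.le.trans hr'.1) (hn r)
    · rw [h.eq_zero r hr', mul_zero]
  have hm0 : 0 ≤ m := integral_nonneg hrn
  obtain ⟨hgi, hgb⟩ := integral_gradient_weighted_le hwg.2.1 hE hr
  refine le_of_forall_pos_le_add fun ε hε => ?_
  -- The first entry puts the displaced mass where the far bound holds, the second to the right of
  -- `α`, and the third makes its contribution at most `ε`.
  set N := max (max (ρ + 1) α) (4 * Real.pi * |C'| * m / ε + 1) with hNdef
  have hN1 : ρ + 1 ≤ N := (le_max_left _ _).trans (le_max_left _ _)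
  have hN2 : α ≤ N := (le_max_right _ _).trans (le_max_left _ _)
  have hN3 : 4 * Real.pi * |C'| * m / ε + 1 ≤ N := le_max_right _ _
  have hN0 : 0 < N := hα0.trans_le hN2
  obtain ⟨η, hη, hηn, hη1⟩ := exists_unit_profile hN0
  have hη' := hη.div_pow hN0 1
  set γ := max β (3 * N)
  have hχ : IsProfile α γ (fun r => r * ϕ r - m * η r) :=
    (h.id_mul.mono le_rfl (le_max_left _ _)).sub
      ((hη.const_mul m).mono hN2 (le_max_right _ _))
  obtain ⟨hψ, hψd⟩ := hχ.antideriv hα0 (by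
    rw [integral_sub h.id_mul.integrable (hη.const_mul m).integrable, integral_const_mul, hη1, ← hm]
    ring)
  set ψ : ℝ → ℝ := fun r => ∫ s in (0 : ℝ)..r, (s * ϕ s - m * η s) with hψdef
  -- `ψ` is a difference of two primitives, each with values in `[0, m]`.
  have hψm : ∀ r, 0 ≤ r → |ψ r| ≤ m := by
    intro r hr'
    have e1 := intervalIntegral_mem_Icc h.id_mul.integrable hrn hr'
    have e2 := intervalIntegral_mem_Icc hη.integrable hηn hr'
    have e3 : ψ r = (∫ s in (0 : ℝ)..r, s * ϕ s) - m * ∫ s in (0 : ℝ)..r, η s := by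
      rw [hψdef, ← intervalIntegral.integral_const_mul]
      exact intervalIntegral.integral_sub h.id_mul.integrable.intervalIntegrable
        (hη.const_mul m).integrable.intervalIntegrable
    rw [hη1] at e2
    have e4 := mul_le_mul_of_nonneg_left e2.2 hm0
    have e5 := mul_nonneg hm0 e2.1
    rw [e3, abs_le]
    constructor <;> linarith [e1.1, e1.2]
  have hdiv := hwg.radial_pairing hψ hα0
  rw [hψd] at hdiv
  have hfl : LocallyIntegrableOn f {x : E3 | (0 : ℝ) < ‖x‖} := by
    have : {x : E3 | (0 : ℝ) < ‖x‖} = {0}ᶜ := by ext x; simp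
    rw [this]
    exact hwg.1
  have hsplit : ∫ x, f x * ((‖x‖ * ϕ ‖x‖ - m * η ‖x‖) / ‖x‖ ^ 2) =
      radialPair f ϕ - m * radialPair f (fun r => η r / r ^ 1) := by
    simp only [radialPair]
    rw [← integral_const_mul, ← integral_sub (h.integrable_mul_radialTest hα0 hα0 hfl)
      ((hη'.integrable_mul_radialTest hN0 hN0 hfl).const_mul m)]
    refine integral_congr_ae ?_
    filter_upwards [Measure.ae_ne volume (0 : E3)] with x hx
    have h0 : ‖x‖ ≠ 0 := by simpa using hx
    field_simp
  have hfarb : |radialPair f (fun r => η r / r ^ 1)| ≤ 4 * Real.pi * |C'| / N := by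
    have hloc1 : LocallyIntegrableOn (fun _ : E3 => |C'| / N) {x : E3 | (0 : ℝ) < ‖x‖} :=
      (locallyIntegrable_const _).locallyIntegrableOn _
    have hb := norm_integral_le_of_norm_le (hη'.integrable_mul_radialTest hN0 hN0 hloc1)
      (f := fun x => f x * (η ‖x‖ / ‖x‖ ^ 1 / ‖x‖)) (by
        filter_upwards [hfar] with x hx
        have hnn : 0 ≤ η ‖x‖ / ‖x‖ ^ 1 / ‖x‖ :=
          div_nonneg (div_nonneg (hηn _) (by positivity)) (norm_nonneg _)
        rw [norm_mul, Real.norm_of_nonneg hnn]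
        by_cases hxN : ‖x‖ ∈ Set.Icc N (3 * N)
        · refine mul_le_mul_of_nonneg_right ?_ hnn
          refine (hx (by linarith [hxN.1])).trans ?_
          calc C' / ‖x‖ ≤ |C'| / ‖x‖ := by gcongr; exact le_abs_self _
            _ ≤ |C'| / N := by gcongr; exact hxN.1
        · rw [hη.eq_zero _ hxN]; simp)
    have hc := radialPair_const hη' hN0 (|C'| / N)
    have he : ∫ r, r * (η r / r ^ 1) = 1 := by
      rw [← hη1]
      refine integral_congr_ae ?_
      filter_upwards [Measure.ae_ne volume (0 : ℝ)] with r hr0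
      field_simp
    rw [he] at hc
    have h5 : |radialPair f (fun r => η r / r ^ 1)| ≤
      radialPair (fun _ => |C'| / N) (fun r => η r / r ^ 1) := hb
    rw [hc] at h5
    refine h5.trans (le_of_eq ?_)
    ring
  have hgrad : |∫ x, inner ℝ (g x) x * (ψ ‖x‖ / ‖x‖ ^ 3)| ≤ m * ((|C| + 2 * Real.pi) / r₀) := by
    have hm' : MeasurableSet {x : E3 | r₀ < ‖x‖} :=
      (isOpen_lt continuous_const continuous_norm).measurableSet
    have hb := norm_integral_le_of_norm_le
      (g := {x : E3 | r₀ < ‖x‖}.indicator fun x => m * (‖g x‖ / ‖x‖ ^ 2))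
      (f := fun x => inner ℝ (g x) x * (ψ ‖x‖ / ‖x‖ ^ 3))
      ((integrable_indicator_iff hm').2 (hgi.const_mul m)) (Eventually.of_forall fun x => by
        by_cases hx : r₀ < ‖x‖
        · rw [Set.indicator_of_mem (show x ∈ {x : E3 | r₀ < ‖x‖} from hx), norm_mul,
            Real.norm_eq_abs, Real.norm_eq_abs, abs_div, abs_of_nonneg (by positivity : 0 ≤ ‖x‖ ^ 3)]
          have hx0 : 0 < ‖x‖ := hr.trans hx
          calc _ ≤ (‖g x‖ * ‖x‖) * (m / ‖x‖ ^ 3) := by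
                gcongr
                · exact abs_real_inner_le_norm _ _
                · exact hψm _ (norm_nonneg _)
            _ = _ := by field_simp
        · rw [Set.indicator_of_notMem (show x ∉ {x : E3 | r₀ < ‖x‖} from hx),
            hψ.eq_zero _ fun h' => hx (hα.trans_le h'.1)]
          simp)
    rw [integral_indicator hm', integral_const_mul] at hb
    exact hb.trans (mul_le_mul_of_nonneg_left hgb hm0)
  have hfin : radialPair f ϕ = m * radialPair f (fun r => η r / r ^ 1) -
      ∫ x, inner ℝ (g x) x * (ψ ‖x‖ / ‖x‖ ^ 3) := by
    rw [hsplit] at hdiv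
    linarith
  have hsmall : m * (4 * Real.pi * |C'| / N) ≤ ε := by
    rw [mul_div_assoc', div_le_iff₀ hN0]
    have h6 : 4 * Real.pi * |C'| * m / ε ≤ N := by linarith
    rw [div_le_iff₀ hε] at h6
    linarith
  have h7 := mul_le_mul_of_nonneg_left hfarb hm0
  rw [hfin]
  calc _ ≤ |m * radialPair f (fun r => η r / r ^ 1)| + |∫ x, inner ℝ (g x) x * (ψ ‖x‖ / ‖x‖ ^ 3)| :=
        abs_sub _ _
    _ ≤ ε + m * ((|C| + 2 * Real.pi) / r₀) := by
        rw [abs_mul, abs_of_nonneg hm0]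
        linarith
    _ = _ := by ring

lemma IsRadialOn.eq_comp_norm {f : E3 → ℝ} {ρ : ℝ} (h : IsRadialOn f {x | ρ < ‖x‖}) (x : E3)
    (hx : ρ < ‖x‖) : f x = f (‖x‖ • EuclideanSpace.single 0 1) := by
  have hn : ‖‖x‖ • (EuclideanSpace.single 0 1 : E3)‖ = ‖x‖ := by simp [norm_smul]
  exact h x hx _ (by simpa [hn] using hx) hn.symm

/-- Pointwise decay of a radial function with bounded energy on annuli which vanishes at
infinity. -/
lemma ae_abs_le_of_energy (hwg : IsWeakGradientOn f g {0}ᶜ) (hrad : IsRadialOn f Set.univ)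
    (hE : ∀ r : ℝ, 0 < r →
      ∫⁻ x in {x : E3 | r < ‖x‖ ∧ ‖x‖ < 4 * r}, ‖g x‖ₑ ^ 2 ≤ ENNReal.ofReal (C * r⁻¹))
    (hfar : ∃ C' ρ : ℝ, ∀ᵐ x, ρ < ‖x‖ → |f x| ≤ C' / ‖x‖) :
    ∀ᵐ x, |f x| ≤ (|C| + 2 * Real.pi) / (2 * Real.pi) / ‖x‖ := by
  have key : ∀ r₀ : ℝ, 0 < r₀ →
      ∀ᵐ x, r₀ < ‖x‖ → |f x| ≤ (|C| + 2 * Real.pi) / (4 * Real.pi * r₀) := by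
    intro r₀ hr
    refine ae_abs_le_of_abs_radialPair_le hr.le
      (fr := fun r => f (r • EuclideanSpace.single 0 1)) (Br := fun _ => _)
      (fun x hx => IsRadialOn.eq_comp_norm (fun x _ y _ => hrad x trivial y trivial) x hx)
      (fun _ _ => rfl) (hwg.1.mono_set fun x hx => ?_)
      ((locallyIntegrable_const _).locallyIntegrableOn _) fun α β ϕ hϕ hα hn => ?_
    · rintro rfl
      have : r₀ < ‖(0 : E3)‖ := hx
      rw [norm_zero] at this
      linarith
    · refine (abs_radialPair_le_of_energy hwg hE hfar hr hϕ hα hn).trans (le_of_eq ?_)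
      rw [radialPair_const hϕ (hr.trans hα)]
      have := Real.pi_ne_zero
      field_simp
  -- Countably many dyadic radii suffice: choosing `2^k < ‖x‖ ≤ 2^(k+1)` costs a factor two, which
  -- accounts for `2π` in place of `4π`.
  have hall : ∀ᵐ x, ∀ k : ℤ, (2 : ℝ) ^ k < ‖x‖ →
      |f x| ≤ (|C| + 2 * Real.pi) / (4 * Real.pi * 2 ^ k) :=
    ae_all_iff.2 fun k => key _ (by positivity)
  filter_upwards [hall, Measure.ae_ne volume (0 : E3)] with x hx hx0
  have hxp : 0 < ‖x‖ := by simpa using hx0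
  obtain ⟨k, hk1, hk2⟩ := exists_mem_Ioc_zpow hxp (one_lt_two (α := ℝ))
  refine (hx k hk1).trans ?_
  rw [zpow_add_one₀ two_ne_zero] at hk2
  rw [div_div]
  refine div_le_div_of_nonneg_left (by positivity) (by positivity) ?_
  have := mul_le_mul_of_nonneg_left hk2 (by positivity : 0 ≤ 2 * Real.pi)
  linarith

end Decay

/-! ### The two stationary functions: `W` and the power barrier -/

section Stationary

lemma IsStationary.of_contDiffOn {R R₁ : ℝ} (hR : 0 ≤ R) (hR₁ : R < R₁) {V : E3 → ℝ}
    (hV : ContDiffOn ℝ 2 V {x | R < ‖x‖}) (hrad : IsRadialOn V {x | R < ‖x‖}) :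
    ∃ v, IsStationary R₁ V (Δ V) v := by
  set e : E3 := EuclideanSpace.single 0 1 with he
  have hv : ContDiffOn ℝ 2 (fun r : ℝ => r * V (r • e)) (Set.Ioi R) := by
    refine contDiffOn_id.mul (hV.comp (contDiffOn_id.smul contDiffOn_const) fun r hr => ?_)
    have hr' : R < r := hr
    have : ‖r • e‖ = r := by simp [norm_smul, he, abs_of_pos (hR.trans_lt hr')]
    simpa [this] using hr'
  obtain ⟨w, hw, hwv⟩ := exists_contDiff_extension hR₁ hv
  have hVw : ∀ x, R₁ < ‖x‖ → V x = w ‖x‖ / ‖x‖ := fun x hx => by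
    have : ‖x‖ ≠ 0 := by linarith
    rw [hwv _ hx.le, hrad.eq_comp_norm x (hR₁.trans hx)]
    field_simp
    rfl
  have hw1 : ContDiff ℝ 1 (deriv w) := by
    have : ContDiff ℝ (1 + 1) w := by simpa [one_add_one_eq_two] using hw
    exact (contDiff_succ_iff_deriv.1 this).2.2
  refine ⟨w, hw, hVw, fun x hx => ?_⟩
  refine laplacian_radial (v₁ := deriv w) (by rintro rfl; rw [norm_zero] at hx; linarith) ?_
    (Eventually.of_forall fun r => ((hw.differentiable (by simp)) r).hasDerivAt)
    ((hw1.differentiable (by simp)) _).hasDerivAt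
  filter_upwards [(isOpen_lt continuous_const continuous_norm).mem_nhds hx] with y hy
  exact hVw y hy

/-- The profile is `r^q`. The barrier is the case of a negative exponent, where `q(q-1) > 0` and the
Laplacian is positive. -/
lemma isStationary_rpow {R₁ : ℝ} (hR₁ : 0 < R₁) (q : ℝ) :
    ∃ v, IsStationary R₁ (fun x => ‖x‖ ^ (q - 1)) (fun x => q * (q - 1) * ‖x‖ ^ (q - 3)) v := by
  have hv : ContDiffOn ℝ 2 (fun r : ℝ => r ^ q) (Set.Ioi 0) := fun r hr =>
    (Real.contDiffAt_rpow_const_of_ne (ne_of_gt hr)).contDiffWithinAt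
  obtain ⟨w, hw, hwv⟩ := exists_contDiff_extension hR₁ hv
  refine ⟨w, hw, fun x hx => ?_, fun x hx => ?_⟩
  · rw [hwv _ hx.le, Real.rpow_sub_one (by linarith)]
  · have h1 : ∀ r, R₁ < r → deriv w r = q * r ^ (q - 1) := fun r hr => by
      have : w =ᶠ[𝓝 r] fun r => r ^ q := by
        filter_upwards [Ioi_mem_nhds hr] with s hs using hwv s (le_of_lt hs)
      rw [this.deriv_eq, (Real.hasDerivAt_rpow_const (Or.inl (by linarith))).deriv]
    have h2 : deriv w =ᶠ[𝓝 ‖x‖] fun r => q * r ^ (q - 1) := by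
      filter_upwards [Ioi_mem_nhds hx] with s hs using h1 s hs
    rw [h2.deriv_eq, ((Real.hasDerivAt_rpow_const (Or.inl (by linarith))).const_mul q).deriv,
      mul_div_assoc, mul_div_assoc, ← Real.rpow_sub_one (by linarith), ← mul_assoc]
    congr 2
    ring

end Stationary

/-! ### Estimates for radial pairings -/

section PairingBounds

variable {α β : ℝ} {ψ : ℝ → ℝ} {ρ : ℝ}

lemma radialPair_neg (f : E3 → ℝ) (ψ : ℝ → ℝ) : radialPair f (fun r => -ψ r) = -radialPair f ψ := by
  simp only [radialPair, neg_div, mul_neg, integral_neg]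

lemma abs_radialPair_le_of_nonneg (h : IsProfile α β ψ) (hα : 0 < α) (hρ : ρ < α)
    (hn : ∀ r, 0 ≤ ψ r) {f L : E3 → ℝ} {c : ℝ} (hL : LocallyIntegrableOn L {x | ρ < ‖x‖})
    (hf : ∀ᵐ x, ρ < ‖x‖ → |f x| ≤ c * L x) : |radialPair f ψ| ≤ c * radialPair L ψ := by
  have hb := norm_integral_le_of_norm_le ((h.integrable_mul_radialTest hα hρ hL).const_mul c)
    (f := fun x => f x * (ψ ‖x‖ / ‖x‖)) (by
      filter_upwards [hf] with x hx
      have hnn : 0 ≤ ψ ‖x‖ / ‖x‖ := div_nonneg (hn _) (norm_nonneg _)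
      rw [norm_mul, Real.norm_of_nonneg hnn, ← mul_assoc]
      by_cases hx' : ‖x‖ ∈ Set.Icc α β
      · exact mul_le_mul_of_nonneg_right (hx (hρ.trans_le hx'.1)) hnn
      · rw [h.eq_zero _ hx']
        simp)
  rw [integral_const_mul] at hb
  exact hb

lemma radialPair_nonneg (h : IsProfile α β ψ) (hρ : ρ < α)
    (hn : ∀ r, 0 ≤ ψ r) {L : E3 → ℝ} (hL : ∀ x, ρ < ‖x‖ → 0 ≤ L x) : 0 ≤ radialPair L ψ := by
  refine integral_nonneg fun x => ?_
  by_cases hx' : ‖x‖ ∈ Set.Icc α β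
  · exact mul_nonneg (hL x (hρ.trans_le hx'.1)) (div_nonneg (hn _) (norm_nonneg _))
  · simp only [h.eq_zero _ hx', zero_div, mul_zero, Pi.zero_apply, le_refl]

/-- The window average is odd in `b`; the sign `ε` lets forward and backward times be treated
together. -/
lemma abs_radialPair_halfWindow_le (h : IsProfile α β ψ) {b ε : ℝ} (hρ0 : 0 ≤ ρ)
    (hρ : ρ < α - |b|) (hn : ∀ r, 0 ≤ ψ r) (hε : ε = 1 ∨ ε = -1) (hb : 0 ≤ ε * b) {f L : E3 → ℝ}
    {c : ℝ} (hL : LocallyIntegrableOn L {x | ρ < ‖x‖}) (hf : ∀ᵐ x, ρ < ‖x‖ → |f x| ≤ c * L x) :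
    |radialPair f (halfWindow ψ b)| ≤ c * (ε * radialPair L (halfWindow ψ b)) := by
  have key : ∀ b, 0 ≤ b → ρ < α - |b| →
      |radialPair f (halfWindow ψ b)| ≤ c * radialPair L (halfWindow ψ b) := fun b hb hρ =>
    abs_radialPair_le_of_nonneg (h.halfWindow b) (hρ0.trans_lt hρ) hρ (halfWindow_nonneg hn hb) hL hf
  rcases hε with rfl | rfl
  · simpa using key b (by linarith) hρ
  · have h1 := key (-b) (by linarith) (by rwa [abs_neg])
    have h2 : halfWindow ψ (-b) = fun r => -halfWindow ψ b r := funext fun r => halfWindow_neg ..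
    rw [h2, radialPair_neg, radialPair_neg, abs_neg] at h1
    simpa using h1

/-- Decay of the pairings of a function that is `O(|x|^{q-1})` with profiles moving to infinity. -/
lemma abs_radialPair_le_of_decay (h : IsProfile α β ψ) (hα : 0 < α) (hρ : ρ < α)
    (hn : ∀ r, 0 ≤ ψ r) {f : E3 → ℝ} {A q : ℝ} (hA : 0 ≤ A) (hq : q ≤ 0)
    (hf : ∀ᵐ x, ρ < ‖x‖ → |f x| ≤ A * ‖x‖ ^ (q - 1)) :
    |radialPair f ψ| ≤ 4 * Real.pi * (A * α ^ q) * ∫ r, ψ r := by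
  have h' := h.div_pow hα 1
  have hloc : LocallyIntegrableOn (fun _ : E3 => A * α ^ q) {x : E3 | (0 : ℝ) < ‖x‖} :=
    (locallyIntegrable_const _).locallyIntegrableOn _
  have hb := norm_integral_le_of_norm_le (h'.integrable_mul_radialTest hα hα hloc)
    (f := fun x => f x * (ψ ‖x‖ / ‖x‖)) (by
      filter_upwards [hf] with x hx
      have hnn : 0 ≤ ψ ‖x‖ / ‖x‖ := div_nonneg (hn _) (norm_nonneg _)
      rw [norm_mul, Real.norm_of_nonneg hnn]
      by_cases hx' : ‖x‖ ∈ Set.Icc α β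
      · have hx0 : 0 < ‖x‖ := hα.trans_le hx'.1
        calc ‖f x‖ * (ψ ‖x‖ / ‖x‖) ≤ A * ‖x‖ ^ (q - 1) * (ψ ‖x‖ / ‖x‖) :=
              mul_le_mul_of_nonneg_right (hx (hρ.trans_le hx'.1)) hnn
          _ = A * ‖x‖ ^ q * (ψ ‖x‖ / ‖x‖ ^ 1 / ‖x‖) := by
              rw [Real.rpow_sub_one hx0.ne']
              field_simp
          _ ≤ A * α ^ q * (ψ ‖x‖ / ‖x‖ ^ 1 / ‖x‖) := by
              have h1 : 0 ≤ ψ ‖x‖ / ‖x‖ ^ 1 / ‖x‖ := by rw [pow_one]; positivity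
              have h2 := Real.rpow_le_rpow_of_nonpos hα hx'.1 hq
              gcongr
      · rw [h.eq_zero _ hx']
        simp)
  have hc := radialPair_const h' hα (A * α ^ q)
  have he : ∫ r, r * (ψ r / r ^ 1) = ∫ r, ψ r := by
    refine integral_congr_ae ?_
    filter_upwards [Measure.ae_ne volume (0 : ℝ)] with r hr0
    field_simp
  rw [he] at hc
  refine (hb.trans (le_of_eq hc)).trans (le_of_eq ?_)
  ring

lemma continuous_halfWindow_uncurry {ψ : ℝ → ℝ} (h : Continuous ψ) :
    Continuous fun z : ℝ × ℝ => halfWindow ψ z.1 z.2 := by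
  have hc : Continuous fun r => ∫ s in (0 : ℝ)..r, ψ s :=
    continuous_iff_continuousAt.2 fun r => (hasDerivAt_integral_of_continuous h r).continuousAt
  simp only [halfWindow_eq h]
  exact continuous_const.mul ((hc.comp (continuous_snd.add continuous_fst)).sub
    (hc.comp (continuous_snd.sub continuous_fst)))

end PairingBounds

/-! ### The Duhamel formula in radial form -/

section Duhamel

variable {p : ℝ} {F : ℝ → ℝ → ℝ} {u : ℝ → E3 → ℝ} {U ut : ℝ → 𝓢'(E3, ℂ)} {α β : ℝ} {ψ : ℝ → ℝ}

lemma integral_mul_radialTest (h : IsProfile α β ψ) (hα : 0 < α) (f : E3 → ℝ) :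
    ∫ x, (f x : ℂ) * radialTest ψ x = radialPair f ψ := by
  rw [radialPair, ← integral_complex_ofReal]
  refine integral_congr_ae (Eventually.of_forall fun x => ?_)
  simp only [radialTest_apply h hα]
  push_cast
  ring

lemma IsGlobalSolution.apply_radialTest (hu : IsGlobalSolution p F u U ut) (h : IsProfile α β ψ)
    (hα : 0 < α) (t : ℝ) : U t (radialTest ψ) = radialPair (u t) ψ := by
  rw [(hu.represents t (radialTest ψ)).2, ← integral_mul_radialTest h hα]
  simp only [mul_comm]

lemma abs_sub_le_of_mem_uIcc {t₀ s τ : ℝ} (hτ : τ ∈ Set.uIcc t₀ (t₀ + s)) : |t₀ + s - τ| ≤ |s| := by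
  have habs := abs_le.1 (le_refl |s|)
  rw [Set.mem_uIcc] at hτ
  rw [abs_le]
  constructor <;> rcases hτ with hτ | hτ <;> linarith [hτ.1, hτ.2]

lemma IsGlobalSolution.radial_duhamel (hu : IsGlobalSolution p F u U ut) (h : IsProfile α β ψ)
    {s : ℝ} (hs : |s| < α) (t₀ : ℝ) :
    (radialPair (u (t₀ + s)) ψ : ℂ) = (1 / 2) * (radialPair (u t₀) (fun r => ψ (r - s)) +
        radialPair (u t₀) (fun r => ψ (r + s))) + ut t₀ (radialTest (halfWindow ψ s)) +
      ((∫ τ in t₀..(t₀ + s), radialPair (fun x => F ‖x‖ (u τ x)) (halfWindow ψ (t₀ + s - τ)) : ℝ) :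
        ℂ) := by
  have habs := abs_le.1 (le_refl |s|)
  have h0 := abs_nonneg s
  have hp : IsProfile (α + -s) (β + -s) fun r => ψ (r + s) := by simpa using h.comp_sub (-s)
  rw [← hu.apply_radialTest h (by linarith), hu.duhamel (t₀ + s) t₀, add_sub_cancel_left,
    freeWave_radialTest h hs, hu.apply_radialTest (h.comp_sub s) (by linarith),
    hu.apply_radialTest hp (by linarith)]
  congr 1
  rw [← intervalIntegral.integral_ofReal]
  refine intervalIntegral.integral_congr fun τ hτ => ?_
  have hτ' := abs_sub_le_of_mem_uIcc hτ
  simp only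
  rw [← integral_mul_radialTest (h.halfWindow _) (by linarith), sinMultiplier_radialTest h
    (by linarith)]

/-- Adding the formulas for `a` and `-a` cancels the velocity terms, as the window average is odd in
its width. No information on `∂ₜu` is then needed. -/
lemma IsGlobalSolution.radial_duhamel_add (hu : IsGlobalSolution p F u U ut) (h : IsProfile α β ψ)
    {a : ℝ} (ha : |a| < α) (t₀ : ℝ) :
    radialPair (u (t₀ + a)) ψ + radialPair (u (t₀ + -a)) ψ =
      radialPair (u t₀) (fun r => ψ (r - a)) + radialPair (u t₀) (fun r => ψ (r + a)) +
      (∫ τ in t₀..(t₀ + a), radialPair (fun x => F ‖x‖ (u τ x)) (halfWindow ψ (t₀ + a - τ))) +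
      ∫ τ in t₀..(t₀ + -a), radialPair (fun x => F ‖x‖ (u τ x)) (halfWindow ψ (t₀ + -a - τ)) := by
  have h1 := hu.radial_duhamel h ha t₀
  have h2 := hu.radial_duhamel h (s := -a) (by rwa [abs_neg]) t₀
  have h3 : radialTest (halfWindow ψ (-a)) = -radialTest (halfWindow ψ a) := by
    ext x
    have hw := h.halfWindow (-a)
    rw [abs_neg] at hw
    rw [neg_apply, radialTest_apply hw (by linarith),
      radialTest_apply (h.halfWindow a) (by linarith), halfWindow_neg]
    push_cast
    ring
  rw [h3, map_neg] at h2
  simp only [sub_neg_eq_add, ← sub_eq_add_neg] at h2 ⊢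
  apply Complex.ofReal_injective
  push_cast
  linear_combination h1 + h2

/-- The forcing term of the Duhamel formula, tested against a radial function, is measurable in
time. -/
lemma aestronglyMeasurable_radialPair_forcing
    (hF : ContinuousOn (fun z : ℝ × ℝ => F z.1 z.2) (Set.Ici 0 ×ˢ Set.univ))
    (hu : AEStronglyMeasurable (fun z : ℝ × E3 => u z.1 z.2)) (hψ : Continuous ψ) (T : ℝ) :
    AEStronglyMeasurable fun τ => radialPair (fun x => F ‖x‖ (u τ x)) (halfWindow ψ (T - τ)) := by
  have hF' : Continuous fun z : ℝ × ℝ => F (max z.1 0) z.2 :=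
    hF.comp_continuous (f := fun z : ℝ × ℝ => (max z.1 0, z.2)) (by fun_prop)
      fun z => ⟨Set.mem_Ici.2 (le_max_right _ _), trivial⟩
  have h1 : AEStronglyMeasurable (fun z : ℝ × E3 => F ‖z.2‖ (u z.1 z.2)) := by
    have h2 := hF'.comp_aestronglyMeasurable
      ((continuous_norm.comp continuous_snd).aestronglyMeasurable.prodMk hu :
        AEStronglyMeasurable (fun z : ℝ × E3 => (‖z.2‖, u z.1 z.2)))
    simpa using h2
  have h3 : AEStronglyMeasurable (fun z : ℝ × E3 => halfWindow ψ (T - z.1) ‖z.2‖ / ‖z.2‖) := by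
    have h4 : Continuous fun z : ℝ × E3 => halfWindow ψ (T - z.1) ‖z.2‖ :=
      (continuous_halfWindow_uncurry hψ).comp
        ((continuous_const.sub continuous_fst).prodMk (continuous_norm.comp continuous_snd))
    exact (h4.measurable.div (continuous_norm.comp continuous_snd).measurable).aestronglyMeasurable
  exact (h1.mul h3).integral_prod_right'

end Duhamel

/-! ### Comparison with the barrier -/

section Comparison

variable {p : ℝ} {F : ℝ → ℝ → ℝ} {u : ℝ → E3 → ℝ} {U ut : ℝ → 𝓢'(E3, ℂ)} {α β ρ : ℝ} {ϕ ψ : ℝ → ℝ}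

lemma radialPair_add (h : IsProfile α β ψ) (hα : 0 < α) (hρ : ρ < α) {f g : E3 → ℝ}
    (hf : LocallyIntegrableOn f {x | ρ < ‖x‖}) (hg : LocallyIntegrableOn g {x | ρ < ‖x‖}) :
    radialPair (fun x => f x + g x) ψ = radialPair f ψ + radialPair g ψ := by
  simp only [radialPair, add_mul]
  exact integral_add (h.integrable_mul_radialTest hα hρ hf) (h.integrable_mul_radialTest hα hρ hg)

lemma radialPair_sub (h : IsProfile α β ψ) (hα : 0 < α) (hρ : ρ < α) {f g : E3 → ℝ}
    (hf : LocallyIntegrableOn f {x | ρ < ‖x‖}) (hg : LocallyIntegrableOn g {x | ρ < ‖x‖}) :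
    radialPair (fun x => f x - g x) ψ = radialPair f ψ - radialPair g ψ := by
  simp only [radialPair, sub_mul]
  exact integral_sub (h.integrable_mul_radialTest hα hρ hf) (h.integrable_mul_radialTest hα hρ hg)

/-- The difference of the Duhamel terms of a solution and of a stationary solution `W` is
controlled by the Duhamel term of a barrier `V`. -/
lemma abs_forcing_difference_le
    (hF : ContinuousOn (fun z : ℝ × ℝ => F z.1 z.2) (Set.Ici 0 ×ˢ Set.univ))
    (hum : AEStronglyMeasurable (fun z : ℝ × E3 => u z.1 z.2))
    (hρ0 : 0 ≤ ρ) {W LW V L : E3 → ℝ} {w v : ℝ → ℝ} (hW : IsStationary ρ W LW w)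
    (hV : IsStationary ρ V L v) (hVn : ∀ x, ρ < ‖x‖ → 0 ≤ V x)
    (hFl : ∀ t, LocallyIntegrableOn (fun x => F ‖x‖ (u t x)) {x | ρ < ‖x‖})
    (hWl : LocallyIntegrableOn LW {x | ρ < ‖x‖}) (hLl : LocallyIntegrableOn L {x | ρ < ‖x‖})
    {c : ℝ} (hc : 0 ≤ c) (hb : ∀ t, ∀ᵐ x, ρ < ‖x‖ → |F ‖x‖ (u t x) + LW x| ≤ c * L x)
    (h : IsProfile α β ψ) (hn : ∀ r, 0 ≤ ψ r) {t₀ s : ℝ} (hs : ρ < α - |s|) :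
    |(∫ τ in t₀..(t₀ + s), radialPair (fun x => F ‖x‖ (u τ x)) (halfWindow ψ (t₀ + s - τ))) +
      (1 / 2 * (radialPair W (fun r => ψ (r - s)) + radialPair W (fun r => ψ (r + s)))
        - radialPair W ψ)| ≤
      c * (1 / 2 * (radialPair V (fun r => ψ (r - s)) + radialPair V (fun r => ψ (r + s)))
        + radialPair V ψ) := by
  have habs := abs_le.1 (le_refl |s|)
  have h0 := abs_nonneg s
  obtain ⟨hWi, hWe⟩ := hW.dalembert hρ0 h (t₀ := t₀) hs
  obtain ⟨hVi, hVe⟩ := hV.dalembert hρ0 h (t₀ := t₀) hs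
  -- `ε` is the orientation of the time interval: one for forward times, minus one for backward
  -- times.
  obtain ⟨ε, hε, hεs⟩ : ∃ ε : ℝ, (ε = 1 ∨ ε = -1) ∧
      ∀ τ ∈ Set.uIoc t₀ (t₀ + s), 0 ≤ ε * (t₀ + s - τ) := by
    rcases le_total 0 s with h1 | h1
    · refine ⟨1, Or.inl rfl, fun τ hτ => ?_⟩
      rw [Set.uIoc_of_le (by linarith)] at hτ
      linarith [hτ.2]
    · refine ⟨-1, Or.inr rfl, fun τ hτ => ?_⟩
      rw [Set.uIoc_of_ge (by linarith)] at hτ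
      linarith [hτ.1]
  have hεabs : |ε| = 1 := by rcases hε with rfl | rfl <;> simp
  have hbound : ∀ τ ∈ Set.uIoc t₀ (t₀ + s),
      |radialPair (fun x => F ‖x‖ (u τ x)) (halfWindow ψ (t₀ + s - τ)) +
        radialPair LW (halfWindow ψ (t₀ + s - τ))| ≤
      c * (ε * radialPair L (halfWindow ψ (t₀ + s - τ))) := by
    intro τ hτ
    have hτ' := abs_sub_le_of_mem_uIcc (Set.uIoc_subset_uIcc hτ)
    rw [← radialPair_add (h.halfWindow _) (by linarith) (by linarith) (hFl τ) hWl]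
    exact abs_radialPair_halfWindow_le h hρ0 (by linarith) hn hε (hεs τ hτ) hLl (hb τ)
  have hgi : IntervalIntegrable
      (fun τ => c * (ε * radialPair L (halfWindow ψ (t₀ + s - τ)))) volume t₀ (t₀ + s) :=
    (hVi.const_mul ε).const_mul c
  -- Integrability in time of the forcing is obtained here: the sum is dominated by the barrier
  -- term, and the part due to `W` is then subtracted.
  have hsumi : IntervalIntegrable (fun τ =>
      radialPair (fun x => F ‖x‖ (u τ x)) (halfWindow ψ (t₀ + s - τ)) +
        radialPair LW (halfWindow ψ (t₀ + s - τ))) volume t₀ (t₀ + s) := by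
    refine hgi.mono_fun' ?_ ?_
    · exact (aestronglyMeasurable_radialPair_forcing hF hum h.continuous _).restrict.add
        (intervalIntegrable_iff.1 hWi).aestronglyMeasurable
    · exact (ae_restrict_iff' measurableSet_uIoc).2 (Eventually.of_forall hbound)
  have hNi : IntervalIntegrable (fun τ =>
      radialPair (fun x => F ‖x‖ (u τ x)) (halfWindow ψ (t₀ + s - τ))) volume t₀ (t₀ + s) := by
    have := hsumi.sub hWi
    refine this.congr fun τ _ => ?_
    simp
  rw [← hWe, ← intervalIntegral.integral_add hNi hWi]
  have h1 := intervalIntegral.norm_integral_le_abs_of_norm_le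
    (f := fun τ => radialPair (fun x => F ‖x‖ (u τ x)) (halfWindow ψ (t₀ + s - τ)) +
      radialPair LW (halfWindow ψ (t₀ + s - τ)))
    ((ae_restrict_iff' measurableSet_uIoc).2 (Eventually.of_forall hbound)) hgi
  refine h1.trans ?_
  rw [intervalIntegral.integral_const_mul, intervalIntegral.integral_const_mul, abs_mul, abs_mul,
    hεabs, one_mul, abs_of_nonneg hc, hVe]
  refine mul_le_mul_of_nonneg_left ?_ hc
  have hp : IsProfile (α + -s) (β + -s) fun r => ψ (r + s) := by simpa using h.comp_sub (-s)
  -- The barrier identity carries a minus sign on its last term; positivity of `V` allows the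
  -- absolute value to be bounded by the sum.
  have n1 := radialPair_nonneg (h.comp_sub s) (by linarith) (fun r => hn _) hVn
  have n2 := radialPair_nonneg hp (by linarith) (fun r => hn _) hVn
  have n3 := radialPair_nonneg h (by linarith) hn hVn
  rw [abs_le]
  constructor <;> linarith

/-- If the forcing of the difference `u - W` is dominated by the Laplacian of the barrier
`c |x|^{2q-1}`, then `u - W` is dominated by the barrier. -/
lemma ae_abs_sub_le_barrier (hu : IsGlobalSolution p F u U ut)
    (hF : ContinuousOn (fun z : ℝ × ℝ => F z.1 z.2) (Set.Ici 0 ×ˢ Set.univ))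
    (hρ1 : 1 ≤ ρ) {q : ℝ} (hq : q < 0) {W LW : E3 → ℝ} {w : ℝ → ℝ} (hW : IsStationary ρ W LW w)
    (hul : ∀ t, LocallyIntegrableOn (u t) {x | ρ < ‖x‖})
    (hurad : ∀ t, IsRadialOn (u t) {x | ρ < ‖x‖})
    (hFl : ∀ t, LocallyIntegrableOn (fun x => F ‖x‖ (u t x)) {x | ρ < ‖x‖})
    (hWl : LocallyIntegrableOn W {x | ρ < ‖x‖}) (hLWl : LocallyIntegrableOn LW {x | ρ < ‖x‖})
    {A c : ℝ} (hA : 0 ≤ A) (hc : 0 ≤ c)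
    (hh : ∀ t, ∀ᵐ x, ρ < ‖x‖ → |u t x - W x| ≤ A * ‖x‖ ^ (q - 1))
    (hb : ∀ t, ∀ᵐ x, ρ < ‖x‖ →
      |F ‖x‖ (u t x) + LW x| ≤ c * (2 * q * (2 * q - 1) * ‖x‖ ^ (2 * q - 3))) (t : ℝ) :
    ∀ᵐ x, ρ < ‖x‖ → |u t x - W x| ≤ c * ‖x‖ ^ (2 * q - 1) := by
  have hρ0 : 0 < ρ := by linarith
  obtain ⟨v, hV⟩ := isStationary_rpow hρ0 (2 * q)
  have hmeas : MeasurableSet {x : E3 | ρ < ‖x‖} :=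
    (isOpen_lt continuous_const continuous_norm).measurableSet
  have hpow : ∀ a k : ℝ, LocallyIntegrableOn (fun x : E3 => k * ‖x‖ ^ a) {x | ρ < ‖x‖} := fun a k =>
    ContinuousOn.locallyIntegrableOn (continuousOn_const.mul
      (continuous_norm.continuousOn.rpow_const fun x hx =>
        Or.inl (ne_of_gt (hρ0.trans (show ρ < ‖x‖ from hx))))) hmeas
  have hVl : LocallyIntegrableOn (fun x : E3 => ‖x‖ ^ (2 * q - 1)) {x | ρ < ‖x‖} := by
    simpa using hpow (2 * q - 1) 1
  have hVle : ∀ᵐ x : E3, ρ < ‖x‖ → |‖x‖ ^ (2 * q - 1)| ≤ 1 * ‖x‖ ^ (q - 1) :=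
    Eventually.of_forall fun x hx => by
      rw [one_mul, abs_of_nonneg (by positivity)]
      exact Real.rpow_le_rpow_of_exponent_le (by linarith) (by linarith)
  refine ae_abs_le_of_abs_radialPair_le hρ0.le
    (fr := fun r => u t (r • EuclideanSpace.single 0 1) - w r / r)
    (Br := fun r => c * r ^ (2 * q - 1))
    (fun x hx => by rw [(hurad t).eq_comp_norm x hx, hW.eq_div x hx]) (fun _ _ => rfl)
    ((hul t).sub hWl) (hpow _ _) fun α β ϕ hϕ hα hn => ?_
  have hα0 : 0 < α := hρ0.trans hα
  set E : ℝ → ℝ := fun a => 4 * Real.pi * (α + a) ^ q * ∫ r, ϕ r with hE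
  -- Three pairings of `u - W` escape to infinity (times `t ± a` at shift `a`, time `t` at shift
  -- `2a`), each at most `A E(a)`. So do three pairings of the barrier, at shift `a` twice and `2a`
  -- once, each at most `c E(a)`. The unshifted barrier pairing has total weight one.
  have hlim : Tendsto (fun a => radialPair (fun x : E3 => c * ‖x‖ ^ (2 * q - 1)) ϕ +
      3 * (A + c) * E a) atTop (𝓝 (radialPair (fun x : E3 => c * ‖x‖ ^ (2 * q - 1)) ϕ)) := by
    have h1 : Tendsto (fun a => (α + a) ^ q) atTop (𝓝 0) := by
      have := (tendsto_rpow_neg_atTop (neg_pos.2 hq)).comp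
        (tendsto_atTop_add_const_left atTop α tendsto_id)
      simpa [Function.comp_def] using this
    have h2 := (((h1.const_mul (4 * Real.pi)).mul_const (∫ r, ϕ r)).const_mul
      (3 * (A + c))).const_add (radialPair (fun x : E3 => c * ‖x‖ ^ (2 * q - 1)) ϕ)
    simpa [hE] using h2
  refine ge_of_tendsto hlim ?_
  filter_upwards [eventually_ge_atTop 0] with a ha
  have haa : |a| = a := abs_of_nonneg ha
  have hdecay : ∀ (f : E3 → ℝ) (B b : ℝ), 0 ≤ B → a ≤ b →
      (∀ᵐ x, ρ < ‖x‖ → |f x| ≤ B * ‖x‖ ^ (q - 1)) →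
      |radialPair f (fun r => ϕ (r - b))| ≤ B * E a := by
    intro f B b hB hb hf
    have h1 := abs_radialPair_le_of_decay (hϕ.comp_sub b) (by linarith) (by linarith)
      (fun r => hn _) hB hq.le hf
    rw [integral_sub_right_eq_self] at h1
    refine h1.trans ?_
    have h2 : (α + b) ^ q ≤ (α + a) ^ q :=
      Real.rpow_le_rpow_of_nonpos (by linarith) (by linarith) hq.le
    have h3 : 0 ≤ ∫ r, ϕ r := integral_nonneg hn
    calc 4 * Real.pi * (B * (α + b) ^ q) * ∫ r, ϕ r ≤
          4 * Real.pi * (B * (α + a) ^ q) * ∫ r, ϕ r := by gcongr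
      _ = _ := by simp only [hE]; ring
  -- Starting from the profile shifted by `a`, the two characteristics lead to `ϕ` itself and to its
  -- shift by `2a`; the supports stay beyond `ρ` for every `a ≥ 0`.
  have hψ := hϕ.comp_sub a
  have e1 : (fun r => ϕ (r - a - a)) = fun r => ϕ (r - (a + a)) := by
    ext r; congr 1; ring
  have e2 : (fun r => ϕ (r + a - a)) = ϕ := by ext r; simp
  have hduh := hu.radial_duhamel_add hψ (a := a) (by rw [haa]; linarith) t
  have hD := fun s hs => abs_forcing_difference_le hF hu.measurable hρ0.le hW hV
    (fun x _ => by positivity) hFl hLWl (hpow _ _) hc hb hψ (fun r => hn _) (t₀ := t) (s := s) hs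
  have hD1 := hD a (by rw [haa]; linarith)
  have hD2 := hD (-a) (by rw [abs_neg, haa]; linarith)
  simp only [sub_neg_eq_add, ← sub_eq_add_neg, e1, e2] at hduh hD1 hD2
  have hsub : ∀ τ b, 0 ≤ b → radialPair (fun x => u τ x - W x) (fun r => ϕ (r - b)) =
      radialPair (u τ) (fun r => ϕ (r - b)) - radialPair W (fun r => ϕ (r - b)) := fun τ b hb =>
    radialPair_sub (hϕ.comp_sub b) (by linarith) (by linarith) (hul τ) hWl
  have hsub0 : radialPair (fun x => u t x - W x) ϕ = radialPair (u t) ϕ - radialPair W ϕ :=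
    radialPair_sub hϕ hα0 hα (hul t) hWl
  have hd1 := hdecay _ A a hA le_rfl (hh (t + a))
  have hd2 := hdecay _ A a hA le_rfl (hh (t - a))
  have hd3 := hdecay _ A (a + a) hA (by linarith) (hh t)
  have hv1 := hdecay _ 1 a zero_le_one le_rfl hVle
  have hv2 := hdecay _ 1 (a + a) zero_le_one (by linarith) hVle
  rw [hsub _ _ ha] at hd1 hd2
  rw [hsub _ _ (by linarith)] at hd3
  have hcV : radialPair (fun x : E3 => c * ‖x‖ ^ (2 * q - 1)) ϕ =
      c * radialPair (fun x : E3 => ‖x‖ ^ (2 * q - 1)) ϕ := by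
    simp only [radialPair, mul_assoc]
    exact integral_const_mul _ _
  have hE' := mul_le_mul_of_nonneg_left (abs_le.1 hv1).2 hc
  have hE'' := mul_le_mul_of_nonneg_left (abs_le.1 hv2).2 hc
  rw [hsub0, hcV, abs_le]
  rw [abs_le] at hD1 hD2 hd1 hd2 hd3
  constructor <;> linarith [hD1.1, hD1.2, hD2.1, hD2.2, hd1.1, hd1.2, hd2.1, hd2.2, hd3.1, hd3.2]

end Comparison

/-! ### Ingredients of the iteration -/

section Main

variable {F : ℝ → ℝ → ℝ}

lemma locallyIntegrableOn_of_ae_abs_le {ρ : ℝ} {f B : E3 → ℝ} (hf : AEStronglyMeasurable f)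
    (hB : LocallyIntegrableOn B {x | ρ < ‖x‖}) (h : ∀ᵐ x, ρ < ‖x‖ → |f x| ≤ B x) :
    LocallyIntegrableOn f {x | ρ < ‖x‖} := by
  have ho : IsOpen {x : E3 | ρ < ‖x‖} := isOpen_lt continuous_const continuous_norm
  rw [locallyIntegrableOn_iff ho.isLocallyClosed] at hB ⊢
  intro K hK hKc
  refine Integrable.mono' (hB K hK hKc) hf.restrict ?_
  rw [ae_restrict_iff' hKc.measurableSet]
  filter_upwards [h] with x hx hxK using hx (hK hxK)

lemma HasLocalEnergyBound.exists_gradient {C : ℝ} {f : E3 → ℝ} {f₁ : 𝓢'(E3, ℂ)}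
    (h : HasLocalEnergyBound C f f₁) : ∃ g, IsWeakGradientOn f g {0}ᶜ ∧ ∀ r : ℝ, 0 < r →
      ∫⁻ x in {x : E3 | r < ‖x‖ ∧ ‖x‖ < 4 * r}, ‖g x‖ₑ ^ 2 ≤ ENNReal.ofReal (C * r⁻¹) := by
  obtain ⟨g, v, hg, -, hE⟩ := h
  exact ⟨g, hg, fun r hr => (lintegral_mono fun x => le_self_add).trans (hE r hr)⟩

/-- Two functions of size `O(1/|x|)` have `F`-images that differ by at most
`O(|x|^{1-p})` times their difference. -/
lemma abs_sub_le_of_lipschitz {p C₅ K₁ K₂ A a b N : ℝ} {Fr : ℝ → ℝ} (hp : 1 < p) (hN : 0 < N)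
    (hF : ∀ a b, |Fr a - Fr b| ≤ C₅ * |a - b| * (|a| ^ (p - 1) + |b| ^ (p - 1)))
    (ha : |a| ≤ K₁ / N) (hb : |b| ≤ K₂ / N) (hK₁ : 0 ≤ K₁) (hK₂ : 0 ≤ K₂)
    (hab : |a - b| ≤ A * N ^ (2 - p)) :
    |Fr a - Fr b| ≤ |C₅| * (K₁ ^ (p - 1) + K₂ ^ (p - 1)) * A * N ^ (3 - 2 * p) := by
  have h1 : |a| ^ (p - 1) ≤ K₁ ^ (p - 1) * N ^ (1 - p) := by
    refine (Real.rpow_le_rpow (abs_nonneg _) ha (by linarith)).trans (le_of_eq ?_)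
    rw [Real.div_rpow hK₁ hN.le, div_eq_mul_inv, ← Real.rpow_neg hN.le, neg_sub]
  have h2 : |b| ^ (p - 1) ≤ K₂ ^ (p - 1) * N ^ (1 - p) := by
    refine (Real.rpow_le_rpow (abs_nonneg _) hb (by linarith)).trans (le_of_eq ?_)
    rw [Real.div_rpow hK₂ hN.le, div_eq_mul_inv, ← Real.rpow_neg hN.le, neg_sub]
  have h3 : N ^ (3 - 2 * p) = N ^ (2 - p) * N ^ (1 - p) := by
    rw [← Real.rpow_add hN]
    congr 1
    ring
  have h4 : 0 ≤ A * N ^ (2 - p) := (abs_nonneg _).trans hab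
  calc |Fr a - Fr b| ≤ C₅ * |a - b| * (|a| ^ (p - 1) + |b| ^ (p - 1)) := hF a b
    _ ≤ |C₅| * |a - b| * (|a| ^ (p - 1) + |b| ^ (p - 1)) := by
        gcongr
        exact le_abs_self _
    _ ≤ |C₅| * (A * N ^ (2 - p)) * (K₁ ^ (p - 1) * N ^ (1 - p) + K₂ ^ (p - 1) * N ^ (1 - p)) := by
        gcongr
    _ = _ := by rw [h3]; ring

lemma exists_radius {q : ℝ} (hq : q < 0) (k R : ℝ) :
    ∃ ρ : ℝ, R < ρ ∧ 1 ≤ ρ ∧ k * ρ ^ q ≤ 1 / 2 := by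
  have h1 : Tendsto (fun ρ : ℝ => k * ρ ^ q) atTop (𝓝 0) := by
    simpa using (tendsto_rpow_neg_atTop (neg_pos.2 hq)).const_mul k
  obtain ⟨ρ, h⟩ := ((h1.eventually_le_const (by norm_num : (0 : ℝ) < 1 / 2)).and
    ((eventually_gt_atTop R).and (eventually_ge_atTop 1))).exists
  exact ⟨ρ, h.2.1, h.2.2, h.1⟩

lemma exists_decay_const {W : E3 → ℝ}
    (h : W =O[Bornology.cobounded E3] fun x => 1 / ‖x‖) :
    ∃ C R : ℝ, 0 ≤ C ∧ ∀ x, R < ‖x‖ → |W x| ≤ C / ‖x‖ := by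
  obtain ⟨C, hC, hb⟩ := h.exists_nonneg
  obtain ⟨R, -, hR⟩ := (Filter.hasBasis_cobounded_norm (E := E3)).eventually_iff.1 hb.bound
  refine ⟨C, R, hC, fun x hx => ?_⟩
  have := hR (le_of_lt hx)
  simpa [div_eq_mul_inv] using this

/-- A distribution whose primitive in time is constant on an open set vanishes there. -/
lemma IsGlobalSolution.isVanishingOn {p : ℝ} {u : ℝ → E3 → ℝ} {U ut : ℝ → 𝓢'(E3, ℂ)}
    (hu : IsGlobalSolution p F u U ut) {W : E3 → ℝ} {Ω : Set E3}
    (h : ∀ t, ∀ᵐ x, x ∈ Ω → u t x = W x) (t : ℝ) : Distribution.IsVanishingOn (ut t) Ω := by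
  intro φ hφ
  have hconst : ∀ τ, U τ φ = ∫ x, φ x * (W x : ℂ) := fun τ => by
    rw [(hu.represents τ φ).2]
    refine integral_congr_ae ?_
    filter_upwards [h τ] with x hx
    by_cases hxs : x ∈ tsupport φ
    · rw [hx (hφ hxs)]
    · rw [image_eq_zero_of_notMem_tsupport hxs, zero_mul, zero_mul]
  have hd := hu.time_deriv t φ
  simp only [hconst] at hd
  exact hd.unique (hasDerivAt_const _ _)

end Main

end RadialWave

end

/-! ### The contraction argument -/

open RadialWave in
theorem mainTheorem5 (p : ℝ) (hp3 : 3 < p) (hp5 : p < 5)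
    (R_W : ℝ) (hR_W : 0 ≤ R_W) (W : RadialWave.E3 → ℝ)
    (hW_smooth : ContDiffOn ℝ 2 W {x | R_W < ‖x‖})
    (hW_radial : RadialWave.IsRadialOn W {x | R_W < ‖x‖})
    (hW_decay : W =O[Bornology.cobounded RadialWave.E3] fun x => 1 / ‖x‖)
    (hW_grad : (fun x => gradient W x) =O[Bornology.cobounded RadialWave.E3] fun x => 1 / ‖x‖ ^ 2)
    (C₄ C₅ : ℝ) :
    -- `R₀` depends only on `p`, `C₄`, `C₅` and `W`
    ∃ R₀ : ℝ, R_W < R₀ ∧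
      ∀ F : ℝ → ℝ → ℝ,
        ContinuousOn (fun z : ℝ × ℝ => F z.1 z.2) (Set.Ici 0 ×ˢ Set.univ) →
        (∀ r, 0 ≤ r → ∀ a, |F r a| ≤ |a| ^ p) →
        (∀ r, 0 ≤ r → ∀ a b,
          |F r a - F r b| ≤ C₅ * |a - b| * (|a| ^ (p - 1) + |b| ^ (p - 1))) →
        (∀ x, R_W < ‖x‖ → -(Δ W x) = F ‖x‖ (W x)) →
        ∀ (u : ℝ → RadialWave.E3 → ℝ) (U ut : ℝ → 𝓢'(RadialWave.E3, ℂ)),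
          RadialWave.IsGlobalSolution p F u U ut →
          (∀ t, RadialWave.IsRadialOn (u t) Set.univ) →
          (∀ t, RadialWave.HasLocalEnergyBound C₄ (u t) (ut t)) →
          (∃ C ρ : ℝ, ∀ t, ∀ᵐ x, ρ < ‖x‖ → |u t x - W x| ≤ C * (1 / ‖x‖ ^ (p - 2))) →
          ∀ t, (∀ᵐ x, R₀ < ‖x‖ → u t x - W x = 0) ∧
            Distribution.IsVanishingOn (ut t) {x | R₀ < ‖x‖} := by
  obtain ⟨C_W, R₁, hC_W, hWb⟩ := exists_decay_const hW_decay
  -- The decay constant of `ae_abs_le_of_energy`; it depends on `C₄` alone.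
  set K₁ := (|C₄| + 2 * Real.pi) / (2 * Real.pi) with hK₁
  have hK₁0 : 0 ≤ K₁ := by positivity
  set q := 3 - p with hq
  have hq0 : q < 0 := by linarith
  set κ := 2 * q * (2 * q - 1) with hκ
  have hκ0 : 0 < κ := mul_pos_of_neg_of_neg (by linarith) (by linarith)
  set K₂ := |C₅| * (K₁ ^ (p - 1) + C_W ^ (p - 1)) with hK₂
  have hK₂0 : 0 ≤ K₂ := by positivity
  -- `K₂` bounds the Lipschitz factor of `F`, and `K₂ / κ` is what one comparison with the barrier
  -- costs; beyond `R₀` the gain `|x|^q` turns it into at most `1/2`.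
  obtain ⟨R₀, hR₀, hR₀1, hR₀k⟩ := exists_radius hq0 (K₂ / κ) (max R_W R₁)
  have hRW : R_W < R₀ := (le_max_left _ _).trans_lt hR₀
  have hR1 : R₁ < R₀ := (le_max_right _ _).trans_lt hR₀
  refine ⟨R₀, hRW, ?_⟩
  intro F hF hFp hFl hWeq u U ut hu hrad hE ⟨C, ρ, hfar⟩
  have hpos : ∀ {x : E3}, R₀ < ‖x‖ → 0 < ‖x‖ := fun hx => by linarith
  have hmeas : MeasurableSet {x : E3 | R₀ < ‖x‖} :=
    (isOpen_lt continuous_const continuous_norm).measurableSet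
  have hsub : {x : E3 | R₀ < ‖x‖} ⊆ {0}ᶜ := fun x hx => by
    have := hpos hx
    simpa using this
  -- pointwise decay of the solution
  have hub : ∀ t, ∀ᵐ x, |u t x| ≤ K₁ / ‖x‖ := by
    intro t
    obtain ⟨g, hg, hgE⟩ := (hE t).exists_gradient
    -- The solution-dependent `C` and `ρ` serve only to show decay at infinity, using `p - 2 ≥ 1`;
    -- they do not enter `K₁`.
    refine ae_abs_le_of_energy hg (hrad t) hgE ⟨C_W + |C|, max ρ R₀, ?_⟩
    filter_upwards [hfar t] with x hx hxm
    have hx1 := hx ((le_max_left _ _).trans_lt hxm)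
    have hx2 : R₀ < ‖x‖ := (le_max_right _ _).trans_lt hxm
    have hx0 := hpos hx2
    have h1 : C * (1 / ‖x‖ ^ (p - 2)) ≤ |C| / ‖x‖ := by
      rw [mul_one_div]
      have h2 : ‖x‖ ≤ ‖x‖ ^ (p - 2) := by
        simpa using Real.rpow_le_rpow_of_exponent_le (by linarith : 1 ≤ ‖x‖)
          (by linarith : 1 ≤ p - 2)
      calc C / ‖x‖ ^ (p - 2) ≤ |C| / ‖x‖ ^ (p - 2) := by gcongr; exact le_abs_self C
        _ ≤ _ := by gcongr
    have h3 := hWb x (hR1.trans hx2)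
    have h4 := abs_sub_abs_le_abs_sub (u t x) (W x)
    rw [add_div]
    linarith
  have hexp : ∀ x : E3, R₀ < ‖x‖ → 1 / ‖x‖ ^ (p - 2) = ‖x‖ ^ (q - 1) := fun x hx => by
    rw [one_div, ← Real.rpow_neg (norm_nonneg x)]
    congr 1
    simp only [hq]
    ring
  -- local integrability
  have hul : ∀ t, LocallyIntegrableOn (u t) {x | R₀ < ‖x‖} := fun t => by
    obtain ⟨g, hg, -⟩ := (hE t).exists_gradient
    exact hg.1.mono_set hsub
  have hum : ∀ t, AEStronglyMeasurable (u t) := fun t => by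
    obtain ⟨g, hg, -⟩ := (hE t).exists_gradient
    have := hg.1.aestronglyMeasurable
    rwa [restrict_compl_singleton] at this
  have hFull : Continuous fun z : ℝ × ℝ => F (max z.1 0) z.2 :=
    hF.comp_continuous (f := fun z : ℝ × ℝ => (max z.1 0, z.2)) (by fun_prop)
      fun z => ⟨Set.mem_Ici.2 (le_max_right _ _), trivial⟩
  have hFloc : ∀ t, LocallyIntegrableOn (fun x => F ‖x‖ (u t x)) {x | R₀ < ‖x‖} := by
    intro t
    refine locallyIntegrableOn_of_ae_abs_le (B := fun x => (K₁ / ‖x‖) ^ p) ?_ ?_ ?_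
    · have := hFull.comp_aestronglyMeasurable
        (continuous_norm.aestronglyMeasurable.prodMk (hum t) :
          AEStronglyMeasurable fun x : E3 => (‖x‖, u t x))
      simpa using this
    · refine ContinuousOn.locallyIntegrableOn ?_ hmeas
      refine ContinuousOn.rpow_const (continuousOn_const.div continuous_norm.continuousOn
        fun x hx => (hpos hx).ne') fun x hx => Or.inr (by linarith)
    · filter_upwards [hub t] with x hx _
      exact (hFp _ (norm_nonneg x) _).trans (Real.rpow_le_rpow (abs_nonneg _) hx (by linarith))
  have hWc : ContinuousOn W {x | R₀ < ‖x‖} :=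
    hW_smooth.continuousOn.mono fun x hx => hRW.trans hx
  have hWl : LocallyIntegrableOn W {x | R₀ < ‖x‖} := hWc.locallyIntegrableOn hmeas
  have hLWl : LocallyIntegrableOn (Δ W) {x | R₀ < ‖x‖} := by
    refine ContinuousOn.locallyIntegrableOn ?_ hmeas
    -- Continuity of the Laplacian is read off from the equation for `W`.
    have h1 : ContinuousOn (fun x => -F (max ‖x‖ 0) (W x)) {x | R₀ < ‖x‖} :=
      (hFull.comp_continuousOn (continuous_norm.continuousOn.prodMk hWc)).neg
    refine h1.congr fun x hx => ?_
    beta_reduce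
    rw [max_eq_left (norm_nonneg x), ← hWeq x (hRW.trans hx), neg_neg]
  obtain ⟨w, hwst⟩ := IsStationary.of_contDiffOn hR_W hRW hW_smooth hW_radial
  -- the contraction
  have hstep : ∀ A, 0 ≤ A → (∀ t, ∀ᵐ x, R₀ < ‖x‖ → |u t x - W x| ≤ A * ‖x‖ ^ (q - 1)) →
      ∀ t, ∀ᵐ x, R₀ < ‖x‖ → |u t x - W x| ≤ A / 2 * ‖x‖ ^ (q - 1) := by
    intro A hA hh t
    -- Since `F(|x|,W) = -ΔW`, the left side is the forcing difference; with `q = 3 - p`, the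
    -- Lipschitz exponent `3 - 2p` equals `2q - 3`, that of the barrier's Laplacian.
    have hforce : ∀ t, ∀ᵐ x, R₀ < ‖x‖ →
        |F ‖x‖ (u t x) + Δ W x| ≤ K₂ * A / κ * (κ * ‖x‖ ^ (2 * q - 3)) := by
      intro t
      filter_upwards [hub t, hh t] with x hx hxA hx0
      have h1 := abs_sub_le_of_lipschitz (by linarith) (hpos hx0) (hFl ‖x‖ (norm_nonneg x)) hx
        (hWb x (hR1.trans hx0)) hK₁0 hC_W (A := A) (by
          have := hxA hx0
          rwa [show q - 1 = 2 - p by simp only [hq]; ring] at this)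
      rw [← hWeq x (hRW.trans hx0), sub_neg_eq_add] at h1
      refine h1.trans (le_of_eq ?_)
      rw [show 3 - 2 * p = 2 * q - 3 by simp only [hq]; ring]
      field_simp
      rw [hK₂]
      ring
    have h := ae_abs_sub_le_barrier hu hF hR₀1 hq0 hwst hul
      (fun t x _ y _ => hrad t x trivial y trivial) hFloc hWl hLWl hA
      (by positivity : 0 ≤ K₂ * A / κ) hh hforce t
    filter_upwards [h] with x hx hx0
    refine (hx hx0).trans ?_
    have hn := hpos hx0
    calc K₂ * A / κ * ‖x‖ ^ (2 * q - 1) = A * (K₂ / κ * ‖x‖ ^ q) * ‖x‖ ^ (q - 1) := by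
          rw [show 2 * q - 1 = q + (q - 1) by ring, Real.rpow_add hn]
          ring
      _ ≤ A * (K₂ / κ * R₀ ^ q) * ‖x‖ ^ (q - 1) := by
          have := Real.rpow_le_rpow_of_nonpos (by linarith : 0 < R₀) hx0.le hq0.le
          gcongr
      _ ≤ A * (1 / 2) * ‖x‖ ^ (q - 1) := by gcongr
      _ = _ := by ring
  obtain ⟨A₀, hA₀, hinit⟩ : ∃ A₀, 0 ≤ A₀ ∧
      ∀ t, ∀ᵐ x, R₀ < ‖x‖ → |u t x - W x| ≤ A₀ * ‖x‖ ^ (q - 1) := by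
    -- For `‖x‖ > ρ` this is (II). On the remaining shell `R₀ < ‖x‖ ≤ ρ` both functions are
    -- `O(1/‖x‖)`, and `1/‖x‖ = ‖x‖^(-q) ‖x‖^(q-1)` with `-q > 0`.
    refine ⟨|C| + (K₁ + C_W) * (max ρ 1) ^ (-q), by positivity, fun t => ?_⟩
    filter_upwards [hfar t, hub t] with x hx1 hx2 hx0
    have hn := hpos hx0
    have hpw : 0 ≤ ‖x‖ ^ (q - 1) := by positivity
    rw [add_mul]
    rcases lt_or_ge ρ ‖x‖ with hρ | hρ
    · have h1 := hx1 hρ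
      rw [hexp x hx0] at h1
      have h2 : C * ‖x‖ ^ (q - 1) ≤ |C| * ‖x‖ ^ (q - 1) := by
        gcongr
        exact le_abs_self C
      have h3 : 0 ≤ (K₁ + C_W) * (max ρ 1) ^ (-q) * ‖x‖ ^ (q - 1) := by positivity
      linarith
    · have h1 : |u t x - W x| ≤ (K₁ + C_W) / ‖x‖ := by
        rw [add_div]
        exact (abs_sub _ _).trans (add_le_add hx2 (hWb x (hR1.trans hx0)))
      have h2 : 1 / ‖x‖ ≤ (max ρ 1) ^ (-q) * ‖x‖ ^ (q - 1) := by
        have h3 : ‖x‖ ^ (-q) ≤ (max ρ 1) ^ (-q) :=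
          Real.rpow_le_rpow hn.le (hρ.trans (le_max_left _ _)) (by linarith)
        calc 1 / ‖x‖ = ‖x‖ ^ (-q) * ‖x‖ ^ (q - 1) := by
              rw [← Real.rpow_add hn, show -q + (q - 1) = -1 by ring, Real.rpow_neg_one, one_div]
          _ ≤ _ := by gcongr
      have h4 : 0 ≤ |C| * ‖x‖ ^ (q - 1) := by positivity
      calc |u t x - W x| ≤ (K₁ + C_W) * (1 / ‖x‖) := by rwa [mul_one_div]
        _ ≤ (K₁ + C_W) * ((max ρ 1) ^ (-q) * ‖x‖ ^ (q - 1)) := by gcongr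
        _ ≤ _ := by linarith
  have hiter : ∀ n : ℕ, ∀ t, ∀ᵐ x, R₀ < ‖x‖ →
      |u t x - W x| ≤ A₀ * (1 / 2) ^ n * ‖x‖ ^ (q - 1) := by
    intro n
    induction n with
    | zero => simpa using hinit
    | succ n ih =>
      intro t
      have := hstep _ (by positivity) ih t
      simpa [pow_succ, div_eq_mul_inv, mul_assoc] using this
  have hzero : ∀ t, ∀ᵐ x, R₀ < ‖x‖ → u t x - W x = 0 := by
    intro t
    filter_upwards [ae_all_iff.2 fun n => hiter n t] with x hx hx0
    have hlim : Tendsto (fun n : ℕ => A₀ * (1 / 2) ^ n * ‖x‖ ^ (q - 1)) atTop (𝓝 0) := by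
      simpa using ((tendsto_pow_atTop_nhds_zero_of_lt_one (by norm_num : (0 : ℝ) ≤ 1 / 2)
        (by norm_num)).const_mul A₀).mul_const (‖x‖ ^ (q - 1))
    have := ge_of_tendsto' hlim fun n => hx n hx0
    exact abs_nonpos_iff.1 this
  refine fun t => ⟨hzero t, hu.isVanishingOn (W := W) (fun t => ?_) t⟩
  filter_upwards [hzero t] with x hx hx0
  exact sub_eq_zero.1 (hx hx0)
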